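/- Let $R\ge 2$, let $\gamma_1,\dots,\gamma_R\in\mathbb C$ be distinct and let $\delta_1,\dots,\delta_R\in\mathbb C$ be non-zero. Let $K$ be the convex hull of $\{\gamma_1,\dots,\gamma_R\}$ and assume that we are in the generic case: every $\gamma_r$ either is a vertex (extreme point) of $K$ or lies in the interior of $K$, so that no $\gamma_r$ lies in the relative interior of an edge. Let $b(K)$ be the length of the boundary of $K$; if $K$ is a segment (which forces $R=2$), $b(K)$ is by convention twice its length. Put $F(z)=\sum_{r=1}^R\delta_r e^{z\overline{\gamma_r}}$. Then $F$ has only finitely many zeros in each disc $|z|\le E$, and their number $N(E)$ satisfies $$N(E)=\frac{b(K)E}{2\pi}+O(1)\qquad(E\to\infty),$$ both when the zeros are counted without multiplicity and when they are counted with multiplicity. Moreover, let $\alpha=\alpha_0<\alpha_1<\dots<\alpha_m=\beta$ with $m\ge1$, let $A_1,\dots,A_m$ be invertible diagonalizable complex $n\times n$ matrices, put $A(x)=A_s$ for $\alpha_{s-1}<x\le\alpha_s$, let $S,T$ be any complex $n\times n$ matrices, and let $L$ be the operator $(Lf)(x)=A(x)f'(x)$ in $L^2((\alpha,\beta),\mathbb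 C^n)$ whose domain consists of those $f\in W^{1,2}((\alpha,\beta),\mathbb C^n)$ with $Sf(\alpha)+Tf(\beta)=0$. With $U_s(z)=e^{z(\alpha_s-\alpha_{s-1})A_s^{-1}}$, a number $z\in\mathbb C$ is an eigenvalue of $L$ if and only if $F_L(z):=\det\bigl(S+T\,U_m(z)\cdots U_1(z)\bigr)=0$. The function $F_L$ is a (possibly empty) sum $\sum_{r=1}^R\delta_re^{z\overline{\gamma_r}}$ with distinct $\gamma_r$ and non-zero $\delta_r$; and whenever $F_L$ is such a sum in the generic case described above, the number of distinct eigenvalues of $L$ in each disc $|z|\le E$ is finite and equals $b(K)E/2\pi+O(1)$ as $E\to\infty$. -/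

import Mathlib

open MeasureTheory Filter Asymptotics

noncomputable section

/-! ### Exponential sums in the generic case -/

/-- The entire function `F(z) = ∑ r, δ r * exp (z * conj (γ r))`. -/
def expSum {R : ℕ} (δ γ : Fin R → ℂ) (z : ℂ) : ℂ :=
  ∑ r, δ r * Complex.exp (z * (starRingEnd ℂ) (γ r))

/-- The convex hull `K` of the exponents. -/
def hull {R : ℕ} (γ : Fin R → ℂ) : Set ℂ := convexHull ℝ (Set.range γ)

/-- The generic case: at least two terms, distinct exponents, nonzero coefficients, and every
exponent is a vertex of the convex hull `K` or lies in the interior of `K` (so none lies in the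
relative interior of an edge; if `K` is a segment, this forces `R = 2`). -/
structure IsGeneric {R : ℕ} (δ γ : Fin R → ℂ) : Prop where
  two_le : 2 ≤ R
  injective : Function.Injective γ
  coeff_ne_zero : ∀ r, δ r ≠ 0
  extreme : ∀ r, γ r ∈ frontier (hull γ) → γ r ∈ Set.extremePoints ℝ (hull γ)

open Classical in
/-- The length of the boundary of a compact convex set in the plane: the one-dimensional Hausdorff
measure of its frontier if it has interior points, and, with the usual convention that a segment is
a polygon with two coinciding edges, twice the length if it is degenerate. -/
def perimeter (K : Set ℂ) : ℝ :=
  if (interior K).Nonempty then (μH[1] (frontier K)).toReal else 2 * (μH[1] K).toReal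

/-- The zeros of `F` in the closed disc of radius `E` about the origin. -/
def zerosIn (F : ℂ → ℂ) (E : ℝ) : Set ℂ := {z | ‖z‖ ≤ E ∧ F z = 0}

/-- The number of distinct zeros of `F` with `‖z‖ ≤ E`. -/
def zeroCount (F : ℂ → ℂ) (E : ℝ) : ℕ := (zerosIn F E).ncard

/-- The number of zeros of `F` with `‖z‖ ≤ E`, counted with multiplicity. -/
def zeroCountMult (F : ℂ → ℂ) (E : ℝ) : ℕ := ∑ᶠ z ∈ zerosIn F E, analyticOrderNatAt F z

/-! ### First order systems with piecewise constant coefficients -/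

/-- The data of the operator `L f = A(x) f'` on `(α, β)` with values in `ℂⁿ` and boundary
condition `S f(α) + T f(β) = 0`: nodes `α = t 0 < t 1 < ... < t m = β`, invertible diagonalizable
matrices `A s` (the value of `A(x)` on the `s`-th interval) and arbitrary matrices `S`, `T`. -/
structure PiecewiseSystem (n m : ℕ) where
  pos : 0 < m
  t : Fin (m + 1) → ℝ
  strictMono_t : StrictMono t
  A : Fin m → Matrix (Fin n) (Fin n) ℂ
  isUnit_A : ∀ s, IsUnit (A s)
  diagonalizable_A : ∀ s, ∃ (V : Matrix (Fin n) (Fin n) ℂ) (d : Fin n → ℂ),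
    IsUnit V ∧ A s = V * Matrix.diagonal d * V⁻¹
  S : Matrix (Fin n) (Fin n) ℂ
  T : Matrix (Fin n) (Fin n) ℂ

namespace PiecewiseSystem

variable {n m : ℕ} (L : PiecewiseSystem n m)

/-- The left end point. -/
def α : ℝ := L.t 0

/-- The right end point. -/
def β : ℝ := L.t (Fin.last m)

/-- The coefficient matrix `A(x)`, equal to `A s` on the `s`-th interval `(t s, t (s+1)]`. -/
def coeff (x : ℝ) : Matrix (Fin n) (Fin n) ℂ :=
  ∑ s : Fin m, (Set.Ioc (L.t s.castSucc) (L.t s.succ)).indicator (fun _ => L.A s) x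

/-- `f` is (the continuous representative of) an element of the Sobolev space `W^{1,2}((a,b), ℂⁿ)`
with derivative `g`, i.e. `f` is absolutely continuous with derivative `g` in `L²`. -/
def IsW12 (a b : ℝ) (f g : ℝ → Fin n → ℂ) : Prop :=
  MemLp g 2 (volume.restrict (Set.Icc a b)) ∧
    ∀ x ∈ Set.Icc a b, f x = f a + ∫ y in a..x, g y

/-- `z` is an eigenvalue of `L`: there is a nonzero `f` in `W^{1,2}` which satisfies the boundary
condition and `A f' = z f`. -/
def IsEigenvalue (z : ℂ) : Prop :=
  ∃ f g : ℝ → Fin n → ℂ, IsW12 L.α L.β f g ∧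
    Matrix.mulVec L.S (f L.α) + Matrix.mulVec L.T (f L.β) = 0 ∧
    (∀ᵐ x ∂(volume.restrict (Set.Icc L.α L.β)), Matrix.mulVec (L.coeff x) (g x) = z • f x) ∧
    ∃ x ∈ Set.Icc L.α L.β, f x ≠ 0

/-- The transfer matrix `exp (z (t (s+1) - t s) (A s)⁻¹)` of the `s`-th interval. -/
def stepMatrix (z : ℂ) (s : Fin m) : Matrix (Fin n) (Fin n) ℂ :=
  NormedSpace.exp ((z * ((L.t s.succ - L.t s.castSucc : ℝ) : ℂ)) • (L.A s)⁻¹)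

/-- The transfer matrix `U(z, β) = U_m ... U_2 U_1`. -/
def transfer (z : ℂ) : Matrix (Fin n) (Fin n) ℂ :=
  (List.ofFn (L.stepMatrix z)).reverse.prod

/-- The characteristic function `det (S + T U(z, β))`. -/
def charDet (z : ℂ) : ℂ := (L.S + L.T * L.transfer z).det

/-- The eigenvalues of `L` in the closed disc of radius `E` about the origin. -/
def eigenvaluesIn (E : ℝ) : Set ℂ := {z | ‖z‖ ≤ E ∧ L.IsEigenvalue z}

end PiecewiseSystem

end

/-! Write ⟨z, γ⟩ for the real part of z times the conjugate of γ. The r-th term has modulus |δ_r|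
exp⟨z, γ_r⟩. At a zero no term outweighs all the others together, so two exponents come within O(1)
of the maximum of ⟨z, ·⟩. Genericity allows at most two exponents on a supporting line of the hull;
by compactness of the unit circle, of any three exponents one then lies at least c|z| below the
maximum (`IsGeneric.exists_gap`). So at a large zero exactly two exponents compete, they span an
edge, and z lies in a half-strip normal to that edge (`IsGeneric.exists_edge_of_zero`). Half-strips
of different edges are disjoint far out (`exists_edge_separation`).

In the half-strip of the edge (a, b), the coordinate w = z·conj(γ_b - γ_a) + log(δ_b/δ_a) turns F,
up to a nonvanishing factor, into 1 + exp w plus exponentials that decay as Im w grows. A Newton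
iteration with frozen derivative contracts near each (2k+1)πi and yields exactly one zero there,
which is simple (`exists_zero_sequence`). Hence |γ_b - γ_a||z_k| = 2πk + O(1), and the edge
contributes |γ_b - γ_a|E/2π + O(1) zeros. The edge lengths add up to the perimeter
(`IsGeneric.perimeter_eq`); a segment carries two edges, one for each orientation. All large zeros
being simple, multiplicities change the count by a bounded amount only.

For the operator, A f' = z f is solved by an explicit product of matrix exponentials, uniquely by
Gronwall's inequality (`PiecewiseSystem.eq_propagator_mulVec`). An eigenfunction therefore amounts
to a nonzero initial vector satisfying the boundary condition, which is the vanishing of the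
determinant. Diagonalisation makes the matrix entries exponential sums; these form an algebra, so
the determinant is one as well and the count of zeros applies. -/

/-- The real inner product `Re (z * conj g)` of the plane. -/
def planePair (z g : ℂ) : ℝ := z.re * g.re + z.im * g.im

lemma re_mul_conj (z g : ℂ) : (z * (starRingEnd ℂ) g).re = planePair z g := by
  simp [planePair]

lemma planePair_add_smul (u x y : ℂ) (s t : ℝ) :
    planePair u (s • x + t • y) = s * planePair u x + t * planePair u y := by
  simp [planePair]; ring

lemma planePair_sum {ι : Type*} (s : Finset ι) (u : ℂ) (w : ι → ℝ) (x : ι → ℂ) :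
    planePair u (∑ i ∈ s, w i • x i) = ∑ i ∈ s, w i * planePair u (x i) := by
  simp only [planePair, Complex.re_sum, Complex.im_sum, Finset.mul_sum, ← Finset.sum_add_distrib]
  refine Finset.sum_congr rfl fun i _ => ?_
  simp; ring

lemma planePair_self_pos {u : ℂ} (hu : u ≠ 0) : 0 < planePair u u := by
  have := Complex.normSq_pos.2 hu
  rwa [Complex.normSq_apply] at this

/-- The vertices `γ a`, `γ b` are consecutive: all other exponents lie strictly on one side of the
oriented line through them. -/
def IsEdge {R : ℕ} (γ : Fin R → ℂ) (e : Fin R × Fin R) : Prop :=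
  e.1 ≠ e.2 ∧ ∀ c, c ≠ e.1 → c ≠ e.2 →
    0 < ((starRingEnd ℂ) (γ c - γ e.1) * (γ e.2 - γ e.1)).im

/-! ### Supporting lines and edges of the convex hull. -/

section Hull

variable {R : ℕ} {δ γ : Fin R → ℂ}

lemma planePair_le_of_mem_hull {u : ℂ} {h : ℝ} (H : ∀ r, planePair u (γ r) ≤ h) {x : ℂ}
    (hx : x ∈ hull γ) : planePair u x ≤ h := by
  have hconv : Convex ℝ {y | planePair u y ≤ h} := by
    intro y hy z hz s t hs ht hst
    simp only [Set.mem_ofPred_eq, planePair_add_smul] at *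
    calc s * planePair u y + t * planePair u z ≤ s * h + t * h := by gcongr
      _ = h := by rw [← add_mul, hst, one_mul]
  exact convexHull_min (by rintro _ ⟨r, rfl⟩; exact H r) hconv hx

lemma mem_hull (r : Fin R) : γ r ∈ hull γ := subset_convexHull ℝ _ ⟨r, rfl⟩

lemma isCompact_hull : IsCompact (hull γ) := (Set.finite_range γ).isCompact_convexHull ℝ

lemma mem_frontier_hull_of_isMax {u x : ℂ} (hu : u ≠ 0) (hx : x ∈ hull γ)
    (H : ∀ r, planePair u (γ r) ≤ planePair u x) : x ∈ frontier (hull γ) := by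
  refine ⟨subset_closure hx, fun hi => ?_⟩
  have hc : ContinuousAt (fun ε : ℝ => x + ε • u) 0 := by fun_prop
  have h0 : ∀ᶠ ε : ℝ in nhds 0, x + ε • u ∈ interior (hull γ) :=
    hc.eventually (by simpa using isOpen_interior.mem_nhds hi)
  obtain ⟨ε, hε, hεpos⟩ := ((h0.filter_mono nhdsWithin_le_nhds).and
    (self_mem_nhdsWithin (s := Set.Ioi (0 : ℝ)))).exists
  have h1 := planePair_le_of_mem_hull H (interior_subset hε)
  have h2 := planePair_add_smul u x u 1 ε
  rw [one_smul] at h2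
  have := mul_pos (show 0 < ε from hεpos) (planePair_self_pos hu)
  linarith

/-- Up to a rotation and a scaling, `planePair u` and `u.re * y.im - u.im * y.re` are Cartesian
coordinates. The first agrees at the three points, so the second one, along the common line,
supplies the weights. -/
lemma mem_openSegment_of_planePair_eq {u x y z : ℂ} (hu : u ≠ 0)
    (hxy : planePair u x = planePair u y) (hyz : planePair u y = planePair u z)
    (h1 : u.re * x.im - u.im * x.re < u.re * y.im - u.im * y.re)
    (h2 : u.re * y.im - u.im * y.re < u.re * z.im - u.im * z.re) : y ∈ openSegment ℝ x z := by
  set X := u.re * x.im - u.im * x.re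
  set Y := u.re * y.im - u.im * y.re
  set Z := u.re * z.im - u.im * z.re
  have hN := planePair_self_pos hu
  have hZX : 0 < Z - X := by linarith
  refine ⟨(Z - Y) / (Z - X), (Y - X) / (Z - X), div_pos (by linarith) hZX,
    div_pos (by linarith) hZX, by field_simp; ring, ?_⟩
  have hre : ∀ w : ℂ, planePair u u * w.re =
      u.re * planePair u w - u.im * (u.re * w.im - u.im * w.re) := by
    intro w; simp [planePair]; ring
  have him : ∀ w : ℂ, planePair u u * w.im =
      u.im * planePair u w + u.re * (u.re * w.im - u.im * w.re) := by
    intro w; simp [planePair]; ring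
  apply Complex.ext
  · simp only [Complex.add_re, Complex.real_smul, Complex.mul_re, Complex.ofReal_re,
      Complex.ofReal_im, zero_mul, sub_zero]
    have hx := hre x; have hy := hre y; have hz := hre z
    rw [hxy] at hx
    rw [← hyz] at hz
    field_simp
    apply mul_left_cancel₀ hN.ne'
    linear_combination (Z - Y) * hx + (Y - X) * hz - (Z - X) * hy
  · simp only [Complex.add_im, Complex.real_smul, Complex.mul_im, Complex.ofReal_re,
      Complex.ofReal_im, zero_mul, add_zero]
    have hx := him x; have hy := him y; have hz := him z
    rw [hxy] at hx
    rw [← hyz] at hz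
    field_simp
    apply mul_left_cancel₀ hN.ne'
    linear_combination (Z - Y) * hx + (Y - X) * hz - (Z - X) * hy

/-- In the generic case at most two exponents lie on a supporting line of the hull. -/
lemma IsGeneric.not_three_maximizers (hg : IsGeneric δ γ) {u : ℂ} (hu : u ≠ 0) {h : ℝ}
    (H : ∀ r, planePair u (γ r) ≤ h) {a b c : Fin R} (hab : a ≠ b) (hac : a ≠ c) (hbc : b ≠ c)
    (ha : planePair u (γ a) = h) (hb : planePair u (γ b) = h) (hc : planePair u (γ c) = h) :
    False := by
  -- `X` orders the points along the supporting line; of three of them the middle one is not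
  -- extreme.
  set X : Fin R → ℝ := fun r => u.re * (γ r).im - u.im * (γ r).re with hX
  have key : ∀ p q r, planePair u (γ p) = h → planePair u (γ q) = h → planePair u (γ r) = h →
      X p < X q → X q < X r → False := by
    intro p q r hp hq hr h1 h2
    have hf := hg.extreme q (mem_frontier_hull_of_isMax hu (mem_hull q) (by simpa [hq] using H))
    have hs := mem_openSegment_of_planePair_eq hu (hp.trans hq.symm) (hq.trans hr.symm) h1 h2
    have := (mem_extremePoints.1 hf).2 _ (mem_hull p) _ (mem_hull r) hs
    have h3 : p = q := hg.injective this.1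
    exact absurd h1 (by rw [h3]; exact lt_irrefl _)
  have hne : ∀ p q, planePair u (γ p) = h → planePair u (γ q) = h → p ≠ q → X p ≠ X q := by
    intro p q hp hq hpq he
    apply hpq; apply hg.injective
    have hN := planePair_self_pos hu
    simp only [planePair, hX] at *
    apply Complex.ext <;> apply mul_left_cancel₀ hN.ne'
    · linear_combination u.re * (hp - hq) - u.im * he
    · linear_combination u.im * (hp - hq) + u.re * he
  rcases lt_or_gt_of_ne (hne a b ha hb hab) with h1 | h1 <;>
  rcases lt_or_gt_of_ne (hne b c hb hc hbc) with h2 | h2 <;>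
  rcases lt_or_gt_of_ne (hne a c ha hc hac) with h3 | h3
  · exact key a b c ha hb hc h1 h2
  · exact key a b c ha hb hc h1 h2
  · exact key a c b ha hc hb h3 h2
  · exact key c a b hc ha hb h3 h1
  · exact key b a c hb ha hc h1 h3
  · exact key b c a hb hc ha h2 h3
  · exact key c b a hc hb ha h2 h1
  · exact key c b a hc hb ha h2 h1

/-- The functional that is constant on an edge, normalised to be maximal there. -/
lemma im_conj_mul_eq_planePair (x d : ℂ) :
    ((starRingEnd ℂ) x * d).im = - planePair (Complex.I * d) x := by
  simp [planePair]; ring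

lemma planePair_sub (u x y : ℂ) : planePair u (x - y) = planePair u x - planePair u y := by
  simp [planePair]; ring

lemma isEdge_iff_planePair {a b : Fin R} :
    IsEdge γ (a, b) ↔ a ≠ b ∧ ∀ c, c ≠ a → c ≠ b →
      planePair (Complex.I * (γ b - γ a)) (γ c) < planePair (Complex.I * (γ b - γ a)) (γ a) := by
  simp only [IsEdge, im_conj_mul_eq_planePair, planePair_sub]
  refine and_congr_right fun _ => forall_congr' fun c => ?_
  constructor <;> intro h h1 h2 <;> have := h h1 h2 <;> linarith

lemma planePair_I_mul_endpoints (x y : ℂ) :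
    planePair (Complex.I * (y - x)) y = planePair (Complex.I * (y - x)) x := by
  simp [planePair]; ring

/-- Since `u` is orthogonal to `d = γ b - γ a`, it is a nonzero real multiple of `I * d`. The sign
of the factor decides which orientation is the edge. -/
lemma isEdge_of_maximizers (hinj : Function.Injective γ) {u : ℂ} (hu : u ≠ 0) {a b : Fin R}
    (hab : a ≠ b) (he : planePair u (γ a) = planePair u (γ b))
    (H : ∀ c, c ≠ a → c ≠ b → planePair u (γ c) < planePair u (γ a)) :
    IsEdge γ (a, b) ∨ IsEdge γ (b, a) := by
  set d := γ b - γ a with hd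
  have hd0 : d ≠ 0 := sub_ne_zero.2 fun h => hab (hinj h.symm)
  have hN := planePair_self_pos hd0
  have hN' := planePair_self_pos hu
  set s := u.im * d.re - u.re * d.im with hs
  have hud : u.re * d.re + u.im * d.im = 0 := by
    have : planePair u d = 0 := by rw [hd, planePair_sub]; linarith
    exact this
  have hre : planePair d d * u.re = s * (Complex.I * d).re := by
    simp [planePair, hs]; linear_combination d.re * hud
  have him : planePair d d * u.im = s * (Complex.I * d).im := by
    simp [planePair, hs]; linear_combination d.im * hud
  have hp : ∀ x, planePair d d * planePair u x = s * planePair (Complex.I * d) x := by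
    intro x
    have : planePair d d * planePair u x
        = planePair d d * u.re * x.re + planePair d d * u.im * x.im := by
      rw [planePair.eq_def u x]; ring
    rw [this, hre, him, planePair.eq_def _ x]; ring
  have hs0 : s ≠ 0 := by
    intro h0
    have := hp u
    rw [h0, zero_mul] at this
    exact (mul_pos hN hN').ne' this
  have hlt : ∀ c, c ≠ a → c ≠ b →
      s * planePair (Complex.I * d) (γ c) < s * planePair (Complex.I * d) (γ a) := by
    intro c h1 h2
    rw [← hp, ← hp]
    exact mul_lt_mul_of_pos_left (H c h1 h2) hN
  rcases lt_or_gt_of_ne hs0 with h | h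
  · right
    refine isEdge_iff_planePair.2 ⟨hab.symm, fun c h1 h2 => ?_⟩
    have h3 := lt_of_mul_lt_mul_of_nonpos_left (hlt c h2 h1) h.le
    have h4 := planePair_I_mul_endpoints (γ a) (γ b)
    have h5 : Complex.I * (γ a - γ b) = -(Complex.I * d) := by rw [hd]; ring
    have h6 : ∀ x, planePair (-(Complex.I * d)) x = - planePair (Complex.I * d) x := by
      intro x; simp [planePair]; ring
    rw [h5, h6, h6, h4]
    linarith
  · left
    refine isEdge_iff_planePair.2 ⟨hab, fun c h1 h2 => ?_⟩
    exact lt_of_mul_lt_mul_left (hlt c h1 h2) h.le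

/-- A boundary point of the hull is a vertex or lies on an edge. -/
lemma IsGeneric.exists_edge_of_isMax (hg : IsGeneric δ γ) {u x : ℂ} (hu : u ≠ 0)
    (hx : x ∈ hull γ) (H : ∀ r, planePair u (γ r) ≤ planePair u x) :
    (∃ a, x = γ a) ∨ ∃ a b, IsEdge γ (a, b) ∧ x ∈ segment ℝ (γ a) (γ b) := by
  classical
  rw [hull, convexHull_range_eq_exists_affineCombination] at hx
  obtain ⟨s, w, hw0, hw1, rfl⟩ := hx
  rw [s.affineCombination_eq_linear_combination _ _ hw1] at *
  set x := ∑ i ∈ s, w i • γ i with hxdef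
  -- A convex combination reaches the maximum only if all its weight sits on maximizers; genericity
  -- leaves at most two of these.
  have hmax : ∀ i ∈ s, w i ≠ 0 → planePair u (γ i) = planePair u x := by
    have h1 : ∑ i ∈ s, w i * (planePair u x - planePair u (γ i)) = 0 := by
      simp only [mul_sub, Finset.sum_sub_distrib, ← Finset.sum_mul, hw1, one_mul]
      rw [← planePair_sum, sub_self]
    have h2 := (Finset.sum_eq_zero_iff_of_nonneg fun i hi =>
      mul_nonneg (hw0 i hi) (sub_nonneg.2 (H i))).1 h1
    intro i hi hwi
    have := (mul_eq_zero.1 (h2 i hi)).resolve_left hwi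
    linarith
  set s' := s.filter fun i => w i ≠ 0 with hs'
  have hsum : x = ∑ i ∈ s', w i • γ i := by
    rw [hxdef, hs', Finset.sum_filter]
    refine Finset.sum_congr rfl fun i _ => ?_
    by_cases h : w i = 0 <;> simp [h]
  have hsum1 : ∑ i ∈ s', w i = 1 := by rw [hs', Finset.sum_filter_ne_zero, hw1]
  have hmem : ∀ i ∈ s', planePair u (γ i) = planePair u x ∧ 0 ≤ w i := by
    intro i hi
    obtain ⟨h1, h2⟩ := Finset.mem_filter.1 hi
    exact ⟨hmax i h1 h2, hw0 i h1⟩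
  have hcard : s'.card ≤ 2 := by
    by_contra! h
    obtain ⟨a, ha, b, hb, c, hc, hab, hac, hbc⟩ := Finset.two_lt_card.1 h
    exact hg.not_three_maximizers hu H hab hac hbc (hmem a ha).1 (hmem b hb).1 (hmem c hc).1
  have hne : s'.Nonempty := by
    by_contra! h
    rw [h] at hsum1; simp at hsum1
  have hpos := hne.card_pos
  obtain h | h : s'.card = 1 ∨ s'.card = 2 := by omega
  · obtain ⟨a, ha⟩ := Finset.card_eq_one.1 h
    left
    rw [ha, Finset.sum_singleton] at hsum hsum1
    exact ⟨a, by rw [hsum, hsum1, one_smul]⟩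
  · obtain ⟨a, b, hab, ha⟩ := Finset.card_eq_two.1 h
    right
    rw [ha, Finset.sum_pair hab] at hsum hsum1
    have h1 := hmem a (by simp [ha])
    have h2 := hmem b (by simp [ha])
    have hxs : x ∈ segment ℝ (γ a) (γ b) := ⟨w a, w b, h1.2, h2.2, hsum1, hsum.symm⟩
    rcases isEdge_of_maximizers hg.injective hu hab (h1.1.trans h2.1.symm) (fun c hca hcb =>
      lt_of_le_of_ne (h1.1 ▸ H c) fun he =>
        hg.not_three_maximizers hu H hab hca.symm hcb.symm h1.1 h2.1 (he.trans h1.1)) with h | h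
    · exact ⟨a, b, h, hxs⟩
    · exact ⟨b, a, h, by rwa [segment_symm]⟩

lemma exists_planePair_eq (f : ℂ →ₗ[ℝ] ℝ) : ∀ x, f x = planePair ⟨f 1, f Complex.I⟩ x := by
  intro x
  have : x = x.re • (1 : ℂ) + x.im • Complex.I := by simp
  conv_lhs => rw [this]
  rw [map_add, map_smul, map_smul]
  simp [planePair, mul_comm]

/-- Hahn–Banach separates the point from the open interior. A convex set with interior points lies
in the closure of its interior, which carries the inequality over to the exponents. -/
lemma exists_isMax_of_mem_frontier (hi : (interior (hull γ)).Nonempty) {x : ℂ}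
    (hx : x ∈ frontier (hull γ)) :
    x ∈ hull γ ∧ ∃ u ≠ 0, ∀ r, planePair u (γ r) ≤ planePair u x := by
  have hconv : Convex ℝ (hull γ) := convex_convexHull ℝ _
  refine ⟨isCompact_hull.isClosed.closure_subset hx.1, ?_⟩
  obtain ⟨f, hf⟩ := geometric_hahn_banach_open_point hconv.interior isOpen_interior hx.2
  have hp := exists_planePair_eq (f : ℂ →ₗ[ℝ] ℝ)
  simp only [ContinuousLinearMap.coe_coe] at hp
  refine ⟨⟨f 1, f Complex.I⟩, ?_, ?_⟩
  · intro h0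
    obtain ⟨y, hy⟩ := hi
    have := hf y hy
    rw [hp, hp x, h0] at this
    simp [planePair] at this
  · intro r
    rw [← hp, ← hp]
    have hcl : γ r ∈ closure (interior (hull γ)) := by
      rw [hconv.closure_interior_eq_closure_of_nonempty_interior hi]
      exact subset_closure (mem_hull r)
    exact closure_minimal (t := {y | f y ≤ f x}) (fun y hy => (hf y hy).le)
      (isClosed_le f.continuous continuous_const) hcl

/-- Without interior points the direction space of the exponents is proper, so a nonzero functional
kills it. -/
lemma exists_planePair_const (hi : ¬ (interior (hull γ)).Nonempty) (a : Fin R) :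
    ∃ u ≠ 0, ∀ r, planePair u (γ r) = planePair u (γ a) := by
  rw [hull, interior_convexHull_nonempty_iff_affineSpan_eq_top] at hi
  have hlt : vectorSpan ℝ (Set.range γ) < ⊤ := by
    rw [lt_top_iff_ne_top]
    intro h
    exact hi ((AffineSubspace.affineSpan_eq_top_iff_vectorSpan_eq_top_of_nonempty ℝ ℂ ℂ
      (⟨γ a, a, rfl⟩ : (Set.range γ).Nonempty)).2 h)
  obtain ⟨f, hf0, hf⟩ := Submodule.exists_le_ker_of_lt_top _ hlt
  have hp := exists_planePair_eq f
  refine ⟨⟨f 1, f Complex.I⟩, ?_, fun r => ?_⟩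
  · intro h0
    apply hf0
    refine LinearMap.ext fun x => ?_
    rw [hp, h0]
    simp [planePair]
  · have : γ r - γ a ∈ vectorSpan ℝ (Set.range γ) :=
      vsub_mem_vectorSpan ℝ ⟨r, rfl⟩ ⟨a, rfl⟩
    have h1 : f (γ r - γ a) = 0 := hf this
    rw [map_sub, hp, hp (γ a)] at h1
    linarith

lemma not_nonempty_interior_of_planePair_const {u : ℂ} (hu : u ≠ 0) {h : ℝ}
    (H : ∀ r, planePair u (γ r) = h) : ¬ (interior (hull γ)).Nonempty := by
  rintro ⟨x, hx⟩
  have hxK := interior_subset hx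
  have h1 : planePair u x ≤ h := planePair_le_of_mem_hull (fun r => (H r).le) hxK
  have h2 : planePair (-u) x ≤ -h := planePair_le_of_mem_hull (fun r => by
    rw [← H r]; simp [planePair]) hxK
  have h3 : planePair (-u) x = - planePair u x := by simp [planePair]; ring
  refine (mem_frontier_hull_of_isMax hu hxK fun r => ?_).2 hx
  rw [H r]; linarith

end Hull

/-! ### Boundary length as the sum of the edge lengths. -/

section Perimeter

variable {R : ℕ} {δ γ : Fin R → ℂ}

open Classical in
/-- The finite set of oriented edges of the hull. -/
noncomputable def edgeSet (γ : Fin R → ℂ) : Finset (Fin R × Fin R) :=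
  Finset.univ.filter (IsEdge γ)

lemma mem_edgeSet {e : Fin R × Fin R} : e ∈ edgeSet γ ↔ IsEdge γ e := by simp [edgeSet]

lemma IsEdge.planePair_le {a b : Fin R} (h : IsEdge γ (a, b)) (r : Fin R) :
    planePair (Complex.I * (γ b - γ a)) (γ r) ≤ planePair (Complex.I * (γ b - γ a)) (γ a) := by
  by_cases h1 : r = a
  · rw [h1]
  by_cases h2 : r = b
  · rw [h2, planePair_I_mul_endpoints]
  exact ((isEdge_iff_planePair.1 h).2 r h1 h2).le

lemma IsEdge.normal_ne_zero (hinj : Function.Injective γ) {a b : Fin R} (h : IsEdge γ (a, b)) :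
    Complex.I * (γ b - γ a) ≠ 0 :=
  mul_ne_zero Complex.I_ne_zero (sub_ne_zero.2 fun h' => h.1 (hinj h'.symm))

lemma IsEdge.eq_of_planePair_eq {a b c : Fin R} (h : IsEdge γ (a, b))
    (hc : planePair (Complex.I * (γ b - γ a)) (γ c) = planePair (Complex.I * (γ b - γ a)) (γ a)) :
    c = a ∨ c = b := by
  by_contra! hne
  exact ((isEdge_iff_planePair.1 h).2 c hne.1 hne.2).ne hc

lemma segment_subset_hull (a b : Fin R) : segment ℝ (γ a) (γ b) ⊆ hull γ :=
  (convex_convexHull ℝ _).segment_subset (mem_hull a) (mem_hull b)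

lemma planePair_of_mem_segment {a b : Fin R} {x : ℂ} (hx : x ∈ segment ℝ (γ a) (γ b)) :
    planePair (Complex.I * (γ b - γ a)) x = planePair (Complex.I * (γ b - γ a)) (γ a) := by
  obtain ⟨s, t, -, -, hst, rfl⟩ := hx
  rw [planePair_add_smul, planePair_I_mul_endpoints, ← add_mul, hst, one_mul]

lemma IsEdge.segment_subset_frontier (hinj : Function.Injective γ) {a b : Fin R}
    (h : IsEdge γ (a, b)) : segment ℝ (γ a) (γ b) ⊆ frontier (hull γ) := by
  intro x hx
  refine mem_frontier_hull_of_isMax (h.normal_ne_zero hinj) (segment_subset_hull a b hx) fun r => ?_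
  rw [planePair_of_mem_segment hx]
  exact h.planePair_le r

/-- Two opposite edges would bound ⟨·, ·⟩ from both sides and put every exponent on one line. This
ensures that each side of a nondegenerate polygon is counted once. -/
lemma IsEdge.not_symm_of_interior (hinj : Function.Injective γ)
    (hi : (interior (hull γ)).Nonempty) {a b : Fin R} (h : IsEdge γ (a, b)) :
    ¬ IsEdge γ (b, a) := by
  intro h'
  refine not_nonempty_interior_of_planePair_const (h.normal_ne_zero hinj)
    (fun r => le_antisymm (h.planePair_le r) ?_) hi
  have h1 := h'.planePair_le r
  have h2 := planePair_I_mul_endpoints (γ a) (γ b)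
  have h3 : ∀ x, planePair (Complex.I * (γ a - γ b)) x = - planePair (Complex.I * (γ b - γ a)) x := by
    intro x; simp [planePair]; ring
  rw [h3, h3] at h1
  linarith

/-- If a relative interior point of one edge lies on the supporting line of another, both its end
points do. That line contains no exponents but `γ a'` and `γ b'`, so the edges would be equal or
opposite. -/
lemma IsEdge.segment_inter_subset (hinj : Function.Injective γ)
    (hi : (interior (hull γ)).Nonempty) {a b a' b' : Fin R} (h : IsEdge γ (a, b))
    (h' : IsEdge γ (a', b')) (hne : (a, b) ≠ (a', b')) :
    segment ℝ (γ a) (γ b) ∩ segment ℝ (γ a') (γ b') ⊆ {γ a, γ b} := by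
  rintro x ⟨⟨s, t, hs, ht, hst, rfl⟩, hx'⟩
  by_contra hmem
  simp only [Set.mem_insert_iff, Set.mem_singleton_iff, not_or] at hmem
  have hs0 : 0 < s := by
    refine lt_of_le_of_ne hs fun h0 => hmem.2 ?_
    rw [← h0, zero_add] at hst
    rw [← h0, hst]; simp
  have ht0 : 0 < t := by
    refine lt_of_le_of_ne ht fun h0 => hmem.1 ?_
    rw [← h0, add_zero] at hst
    rw [← h0, hst]; simp
  have hp := planePair_of_mem_segment hx'
  rw [planePair_add_smul] at hp
  have ha := h'.planePair_le a
  have hb := h'.planePair_le b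
  set M := planePair (Complex.I * (γ b' - γ a')) (γ a')
  set pa := planePair (Complex.I * (γ b' - γ a')) (γ a)
  set pb := planePair (Complex.I * (γ b' - γ a')) (γ b)
  have hM : s * (M - pa) + t * (M - pb) = 0 := by linear_combination M * hst - hp
  have h1 : 0 ≤ s * (M - pa) := mul_nonneg hs (by linarith)
  have h2 : 0 ≤ t * (M - pb) := mul_nonneg ht (by linarith)
  have h3 : M - pa = 0 := (mul_eq_zero.1 (show s * (M - pa) = 0 by linarith)).resolve_left hs0.ne'
  have h4 : M - pb = 0 := (mul_eq_zero.1 (show t * (M - pb) = 0 by linarith)).resolve_left ht0.ne'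
  have ea := h'.eq_of_planePair_eq (show pa = M by linarith)
  have eb := h'.eq_of_planePair_eq (show pb = M by linarith)
  have hab : a ≠ b := h.1
  rcases ea with rfl | rfl <;> rcases eb with rfl | rfl
  · exact hab rfl
  · exact hne rfl
  · exact h.not_symm_of_interior hinj hi h'
  · exact hab rfl

/-- The edges cover the frontier up to finitely many vertices and overlap in finitely many points;
one-dimensional Hausdorff measure sees neither. -/
lemma IsGeneric.perimeter_of_interior (hg : IsGeneric δ γ)
    (hi : (interior (hull γ)).Nonempty) :
    perimeter (hull γ) = ∑ e ∈ edgeSet γ, ‖γ e.2 - γ e.1‖ := by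
  have : NullSingletonClass (μH[1] : Measure ℂ) := Measure.nullSingletonClass_hausdorff ℂ one_pos
  rw [perimeter, if_pos hi]
  have hsub : (⋃ e ∈ edgeSet γ, segment ℝ (γ e.1) (γ e.2)) ⊆ frontier (hull γ) :=
    Set.iUnion₂_subset fun e he =>
      IsEdge.segment_subset_frontier hg.injective (a := e.1) (b := e.2) (mem_edgeSet.1 he)
  have hsup : frontier (hull γ) ⊆
      (⋃ e ∈ edgeSet γ, segment ℝ (γ e.1) (γ e.2)) ∪ Set.range γ := by
    intro x hx
    obtain ⟨hxK, u, hu, hmax⟩ := exists_isMax_of_mem_frontier hi hx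
    rcases hg.exists_edge_of_isMax hu hxK hmax with ⟨a, rfl⟩ | ⟨a, b, he, hxs⟩
    · exact Or.inr ⟨a, rfl⟩
    · exact Or.inl (Set.mem_biUnion (mem_edgeSet.2 he) hxs)
  have heq : μH[1] (frontier (hull γ)) = μH[1] (⋃ e ∈ edgeSet γ, segment ℝ (γ e.1) (γ e.2)) := by
    refine le_antisymm ((measure_mono hsup).trans ((measure_union_le _ _).trans ?_))
      (measure_mono hsub)
    rw [(Set.finite_range γ).measure_zero, add_zero]
  rw [heq, measure_biUnion_finset₀, ENNReal.toReal_sum]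
  · refine Finset.sum_congr rfl fun e _ => ?_
    rw [hausdorffMeasure_segment, edist_comm, edist_dist, ENNReal.toReal_ofReal dist_nonneg,
      dist_eq_norm]
  · intro e _
    rw [hausdorffMeasure_segment]
    exact edist_ne_top _ _
  · rintro ⟨a, b⟩ he ⟨a', b'⟩ he' hne
    exact measure_mono_null (IsEdge.segment_inter_subset hg.injective hi (mem_edgeSet.1 he)
      (mem_edgeSet.1 he') hne) ((Set.toFinite _).measure_zero _)
  · intro e _
    have : IsCompact (segment ℝ (γ e.1) (γ e.2)) := by
      rw [← convexHull_pair]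
      exact (Set.toFinite _).isCompact_convexHull ℝ
    exact this.isClosed.measurableSet.nullMeasurableSet

/-- All exponents lie on a line, so there are only two. Both orientations are then edges, vacuously,
which matches the factor 2 in the convention for segments. -/
lemma IsGeneric.perimeter_of_not_interior (hg : IsGeneric δ γ)
    (hi : ¬ (interior (hull γ)).Nonempty) :
    perimeter (hull γ) = ∑ e ∈ edgeSet γ, ‖γ e.2 - γ e.1‖ := by
  have hR : R = 2 := by
    refine le_antisymm ?_ hg.two_le
    by_contra! hlt
    obtain ⟨u, hu, H⟩ := exists_planePair_const hi ⟨0, by omega⟩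
    exact hg.not_three_maximizers hu (fun r => (H r).le) (a := ⟨0, by omega⟩)
      (b := ⟨1, by omega⟩) (c := ⟨2, by omega⟩) (by simp) (by simp) (by simp) (H _) (H _) (H _)
  subst hR
  rw [perimeter, if_neg hi]
  have hE : edgeSet γ = {((0 : Fin 2), (1 : Fin 2)), (1, 0)} := by
    ext e
    rw [mem_edgeSet]
    obtain ⟨a, b⟩ := e
    fin_cases a <;> fin_cases b <;> simp [IsEdge, Fin.forall_fin_two]
  have hK : hull γ = segment ℝ (γ 0) (γ 1) := by
    rw [← convexHull_pair, hull]
    congr 1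
    ext x
    simp [Fin.exists_fin_two, eq_comm]
  rw [hK, hE, Finset.sum_pair (by simp), hausdorffMeasure_segment, edist_dist,
    ENNReal.toReal_ofReal dist_nonneg, dist_eq_norm, norm_sub_rev (γ 1) (γ 0)]
  ring

/-- The boundary length of the hull is the sum of the lengths of its oriented edges. -/
theorem IsGeneric.perimeter_eq (hg : IsGeneric δ γ) :
    perimeter (hull γ) = ∑ e ∈ edgeSet γ, ‖γ e.2 - γ e.1‖ := by
  by_cases hi : (interior (hull γ)).Nonempty
  · exact hg.perimeter_of_interior hi
  · exact hg.perimeter_of_not_interior hi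

end Perimeter

/-! ### Zeros of small perturbations of 1 + exp w in a vertical strip. -/

section Local

lemma norm_cexp_mul_le {C : ℝ} {w μ : ℂ} (hw : |w.re| ≤ C) :
    ‖Complex.exp (w * μ)‖ ≤ Real.exp (C * |μ.re| - w.im * μ.im) := by
  rw [Complex.norm_exp, Complex.mul_re]
  refine Real.exp_le_exp.2 (sub_le_sub_right ?_ _)
  calc w.re * μ.re ≤ |w.re * μ.re| := le_abs_self _
    _ = |w.re| * |μ.re| := abs_mul _ _
    _ ≤ C * |μ.re| := by gcongr

/-- Exponentials that decay in the direction of the imaginary axis are uniformly small far up in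
a vertical strip. -/
lemma exists_tail_bound {ι : Type*} (s : Finset ι) (β μ : ι → ℂ) (hμ : ∀ i ∈ s, 0 < (μ i).im)
    (C : ℝ) {η : ℝ} (hη : 0 < η) :
    ∃ W : ℝ, ∀ w : ℂ, |w.re| ≤ C → W ≤ w.im →
      ‖∑ i ∈ s, β i * Complex.exp (w * μ i)‖ ≤ η := by
  have hlim : Tendsto (fun y : ℝ => ∑ i ∈ s, ‖β i‖ * Real.exp (C * |(μ i).re| - y * (μ i).im))
      atTop (nhds (∑ i ∈ s, ‖β i‖ * 0)) := by
    refine tendsto_finsetSum _ fun i hi => Tendsto.const_mul _ (Real.tendsto_exp_atBot.comp ?_)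
    simp only [sub_eq_add_neg]
    exact tendsto_atBot_add_const_left _ _
      (tendsto_neg_atTop_atBot.comp (tendsto_id.atTop_mul_const (hμ i hi)))
  simp only [mul_zero, Finset.sum_const_zero] at hlim
  obtain ⟨W, hW⟩ := eventually_atTop.1 (hlim.eventually (ge_mem_nhds hη))
  refine ⟨W, fun w hw hWw => (norm_sum_le _ _).trans (le_trans ?_ (hW _ hWw))⟩
  refine Finset.sum_le_sum fun i _ => ?_
  rw [norm_mul]
  gcongr
  exact norm_cexp_mul_le hw

/-- The zeros of `1 + exp w`. -/
noncomputable def oddPiI (k : ℤ) : ℂ := (2 * k + 1) * Real.pi * Complex.I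

lemma exp_oddPiI (k : ℤ) : Complex.exp (oddPiI k) = -1 := by
  have : oddPiI k = Real.pi * Complex.I + k * (2 * Real.pi * Complex.I) := by
    simp [oddPiI]; ring
  rw [this, Complex.exp_add, Complex.exp_int_mul_two_pi_mul_I, Complex.exp_pi_mul_I, mul_one]

lemma oddPiI_re (k : ℤ) : (oddPiI k).re = 0 := by simp [oddPiI]

lemma oddPiI_im (k : ℤ) : (oddPiI k).im = (2 * k + 1) * Real.pi := by simp [oddPiI]

/-- With y = -(1 + exp w), the number w is log(1 + y) up to an odd multiple of πi, and |log(1 + y)|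
≤ 3/2 · |y| ≤ 3/32. -/
lemma exists_oddPiI_near {w : ℂ} (hw : ‖1 + Complex.exp w‖ ≤ 1 / 16) :
    ∃ k : ℤ, w ∈ Metric.closedBall (oddPiI k) (1 / 8) := by
  set y := -(1 + Complex.exp w) with hy
  have hyn : ‖y‖ ≤ 1 / 16 := by rwa [hy, norm_neg]
  have h1 : 1 + y = -Complex.exp w := by rw [hy]; ring
  have h2 : Complex.exp (Complex.log (1 + y)) = -Complex.exp w := by
    rw [Complex.exp_log, h1]
    rw [h1]; exact neg_ne_zero.2 (Complex.exp_ne_zero _)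
  have h3 : Complex.exp w = Complex.exp (Complex.log (1 + y) + oddPiI 0) := by
    rw [Complex.exp_add, h2, exp_oddPiI]; ring
  obtain ⟨n, hn⟩ := Complex.exp_eq_exp_iff_exists_int.1 h3
  refine ⟨n, ?_⟩
  rw [Metric.mem_closedBall, dist_eq_norm]
  have h4 : w - oddPiI n = Complex.log (1 + y) := by
    rw [hn]; simp [oddPiI]; ring
  rw [h4]
  calc _ ≤ 3 / 2 * ‖y‖ := Complex.norm_log_one_add_half_le_self (by linarith)
    _ ≤ 1 / 8 := by linarith

variable {e e' : ℂ → ℂ} {k : ℤ}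

lemma norm_deriv_perturbed_add_one_le {w : ℂ} (hw : w ∈ Metric.closedBall (oddPiI k) (1 / 8))
    (he : ‖e' w‖ ≤ 1 / 16) : ‖1 + (Complex.exp w + e' w)‖ ≤ 1 / 2 := by
  rw [Metric.mem_closedBall, dist_eq_norm] at hw
  have h1 : Complex.exp w = -Complex.exp (w - oddPiI k) := by
    rw [Complex.exp_sub, exp_oddPiI]; ring
  have h2 := Complex.norm_exp_sub_one_le (x := w - oddPiI k) (by linarith)
  calc ‖1 + (Complex.exp w + e' w)‖ = ‖-(Complex.exp (w - oddPiI k) - 1) + e' w‖ := by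
        rw [h1]; ring_nf
    _ ≤ ‖-(Complex.exp (w - oddPiI k) - 1)‖ + ‖e' w‖ := norm_add_le _ _
    _ ≤ 1 / 2 := by rw [norm_neg]; linarith

/-- The derivative of 1 + exp is -1 at its zeros, so adding the function to w is Newton's map with
frozen derivative. Its own derivative is at most 1/2 on the disc, and the mean value inequality
applies. -/
lemma norm_newton_sub_le (hd : ∀ w, HasDerivAt e (e' w) w)
    (he' : ∀ w ∈ Metric.closedBall (oddPiI k) (1 / 8), ‖e' w‖ ≤ 1 / 16) {x y : ℂ}
    (hx : x ∈ Metric.closedBall (oddPiI k) (1 / 8))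
    (hy : y ∈ Metric.closedBall (oddPiI k) (1 / 8)) :
    ‖(y + (1 + Complex.exp y + e y)) - (x + (1 + Complex.exp x + e x))‖ ≤ 1 / 2 * ‖y - x‖ := by
  refine (convex_closedBall (oddPiI k) (1 / 8)).norm_image_sub_le_of_norm_hasDerivWithin_le
    (f := fun w => w + (1 + Complex.exp w + e w)) (f' := fun w => 1 + (Complex.exp w + e' w))
    (fun w _ => ?_) (fun w hw => norm_deriv_perturbed_add_one_le hw (he' w hw)) hx hy
  exact ((hasDerivAt_id w).add
    (((Complex.hasDerivAt_exp w).const_add 1).add (hd w))).hasDerivWithinAt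

/-- A small perturbation of `1 + exp w` has a zero near each zero of `1 + exp w`. -/
lemma exists_zero_near (hd : ∀ w, HasDerivAt e (e' w) w)
    (he : ‖e (oddPiI k)‖ ≤ 1 / 16)
    (he' : ∀ w ∈ Metric.closedBall (oddPiI k) (1 / 8), ‖e' w‖ ≤ 1 / 16) :
    ∃ w ∈ Metric.closedBall (oddPiI k) (1 / 8), 1 + Complex.exp w + e w = 0 := by
  set N : ℂ → ℂ := fun w => w + (1 + Complex.exp w + e w) with hN
  have hc : oddPiI k ∈ Metric.closedBall (oddPiI k) (1 / 8) :=
    Metric.mem_closedBall_self (by norm_num)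
  have hmaps : Set.MapsTo N (Metric.closedBall (oddPiI k) (1 / 8))
      (Metric.closedBall (oddPiI k) (1 / 8)) := by
    intro w hw
    have h1 := norm_newton_sub_le hd he' hc hw
    rw [exp_oddPiI] at h1
    rw [Metric.mem_closedBall, dist_eq_norm] at hw ⊢
    calc ‖N w - oddPiI k‖ = ‖((w + (1 + Complex.exp w + e w))
          - (oddPiI k + (1 + -1 + e (oddPiI k)))) + e (oddPiI k)‖ := by rw [hN]; ring_nf
      _ ≤ 1 / 2 * ‖w - oddPiI k‖ + 1 / 16 := (norm_add_le _ _).trans (add_le_add h1 he)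
      _ ≤ 1 / 8 := by linarith
  have hcontr : ContractingWith (1 / 2 : NNReal) (hmaps.restrict N _ _) := by
    refine ⟨by norm_num, LipschitzWith.of_dist_le_mul fun x y => ?_⟩
    have := norm_newton_sub_le hd he' y.2 x.2
    rw [Subtype.dist_eq, Subtype.dist_eq, dist_eq_norm, dist_eq_norm]
    simpa using this
  obtain ⟨w, hw, hfix, -⟩ := hcontr.exists_fixedPoint' Metric.isClosed_closedBall.isComplete
    hmaps hc (edist_ne_top _ _)
  refine ⟨w, hw, ?_⟩
  have h : w + (1 + Complex.exp w + e w) = w := hfix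
  simpa using h

/-- Zeros are fixed points of a map that halves distances. -/
lemma zero_near_unique (hd : ∀ w, HasDerivAt e (e' w) w)
    (he' : ∀ w ∈ Metric.closedBall (oddPiI k) (1 / 8), ‖e' w‖ ≤ 1 / 16) {x y : ℂ}
    (hx : x ∈ Metric.closedBall (oddPiI k) (1 / 8))
    (hy : y ∈ Metric.closedBall (oddPiI k) (1 / 8))
    (hx0 : 1 + Complex.exp x + e x = 0) (hy0 : 1 + Complex.exp y + e y = 0) : x = y := by
  have h := norm_newton_sub_le hd he' hx hy
  rw [hx0, hy0, add_zero, add_zero] at h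
  have : ‖y - x‖ = 0 := le_antisymm (by linarith) (norm_nonneg _)
  exact (sub_eq_zero.1 (norm_eq_zero.1 this)).symm

/-- In a vertical strip, the zeros far up of a perturbation of `1 + exp w` by decaying exponentials
form a sequence of simple zeros close to the zeros of `1 + exp w`. -/
lemma exists_zero_sequence {ι : Type*} (s : Finset ι) (β μ : ι → ℂ)
    (hμ : ∀ i ∈ s, 0 < (μ i).im) {C : ℝ} (hC : 1 ≤ C) (V : ℝ) :
    ∃ (k₀ : ℕ) (W : ℝ) (ω : ℕ → ℂ),
      (∀ k, 1 + Complex.exp (ω k) + ∑ i ∈ s, β i * Complex.exp (ω k * μ i) = 0) ∧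
      (∀ k, Complex.exp (ω k) + ∑ i ∈ s, β i * μ i * Complex.exp (ω k * μ i) ≠ 0) ∧
      (∀ k, |(ω k).re| ≤ 1) ∧ (∀ k, V ≤ (ω k).im) ∧
      (∀ k, ω k ∈ Metric.closedBall (oddPiI (k + k₀ : ℕ)) (1 / 8)) ∧
      ∀ w : ℂ, |w.re| ≤ C → W ≤ w.im →
        1 + Complex.exp w + ∑ i ∈ s, β i * Complex.exp (w * μ i) = 0 → ∃ k, w = ω k := by
  obtain ⟨W₁, hW₁⟩ := exists_tail_bound s β μ hμ C (η := 1 / 16) (by norm_num)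
  obtain ⟨W₂, hW₂⟩ := exists_tail_bound s (fun i => β i * μ i) μ hμ C (η := 1 / 16) (by norm_num)
  set e : ℂ → ℂ := fun w => ∑ i ∈ s, β i * Complex.exp (w * μ i) with he
  set e' : ℂ → ℂ := fun w => ∑ i ∈ s, β i * μ i * Complex.exp (w * μ i) with he'
  have hd : ∀ w, HasDerivAt e (e' w) w := by
    intro w
    refine HasDerivAt.fun_sum fun i _ => ?_
    have := (((hasDerivAt_id w).mul_const (μ i)).cexp).const_mul (β i)
    refine this.congr_deriv ?_
    simp; ring
  -- The first `k₀` discs are discarded so that the remaining ones lie above `V` and above both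
  -- thresholds for the perturbation and its derivative.
  obtain ⟨k₀, hk₀⟩ := exists_nat_ge (max V (max W₁ W₂) + 1)
  have hpi := Real.pi_gt_three
  have hk₀' : max V (max W₁ W₂) + 1 ≤ (2 * k₀ + 1) * Real.pi := by
    have : (0 : ℝ) ≤ k₀ := Nat.cast_nonneg _
    nlinarith
  have hV : V ≤ max V (max W₁ W₂) := le_max_left _ _
  have h₁ : W₁ ≤ max V (max W₁ W₂) := le_max_of_le_right (le_max_left _ _)
  have h₂ : W₂ ≤ max V (max W₁ W₂) := le_max_of_le_right (le_max_right _ _)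
  have hball : ∀ j : ℕ, ∀ w ∈ Metric.closedBall (oddPiI (j + k₀ : ℕ)) (1 / 8),
      |w.re| ≤ 1 ∧ max V (max W₁ W₂) ≤ w.im := by
    intro j w hw
    rw [Metric.mem_closedBall, dist_eq_norm] at hw
    have hre := (Complex.abs_re_le_norm _).trans hw
    have him := (abs_le.1 ((Complex.abs_im_le_norm _).trans hw)).1
    rw [Complex.sub_re, oddPiI_re, sub_zero] at hre
    rw [Complex.sub_im, oddPiI_im] at him
    push_cast at him
    have : (0 : ℝ) ≤ j * Real.pi := by positivity
    exact ⟨by linarith, by nlinarith⟩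
  have hsmall : ∀ j : ℕ, ∀ w ∈ Metric.closedBall (oddPiI (j + k₀ : ℕ)) (1 / 8),
      ‖e' w‖ ≤ 1 / 16 := fun j w hw =>
    hW₂ w ((hball j w hw).1.trans hC) (h₂.trans (hball j w hw).2)
  have hex : ∀ j : ℕ, ∃ w ∈ Metric.closedBall (oddPiI (j + k₀ : ℕ)) (1 / 8),
      1 + Complex.exp w + e w = 0 := by
    intro j
    have hc := hball j _ (Metric.mem_closedBall_self (by norm_num))
    exact exists_zero_near hd (hW₁ _ (hc.1.trans hC) (h₁.trans hc.2)) (hsmall j)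
  choose ω hω hω0 using hex
  -- This height exceeds both the tail threshold and every disc of index below `k₀`, so a zero above
  -- it falls into a retained disc. At a double zero the Newton map would have derivative 1, not at
  -- most 1/2.
  refine ⟨k₀, |max V (max W₁ W₂)| + 2 * k₀ * Real.pi + 1, ω, hω0, fun k h0 => ?_,
    fun k => (hball k _ (hω k)).1, fun k => hV.trans (hball k _ (hω k)).2, hω, ?_⟩
  · have := norm_deriv_perturbed_add_one_le (hω k) (hsmall k _ (hω k))
    rw [show Complex.exp (ω k) + e' (ω k) = 0 from h0] at this
    norm_num at this
  · intro w hwC hwW hw0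
    have habs := le_abs_self (max V (max W₁ W₂))
    have hk0 : (0 : ℝ) ≤ 2 * k₀ * Real.pi := by positivity
    have hsm := hW₁ w hwC (by linarith)
    obtain ⟨j, hj⟩ := exists_oddPiI_near (w := w) (by
      rw [show 1 + Complex.exp w = -∑ i ∈ s, β i * Complex.exp (w * μ i) from
        eq_neg_of_add_eq_zero_left hw0, norm_neg]
      exact hsm)
    have hjk : (k₀ : ℤ) ≤ j := by
      by_contra! hlt
      have hlt' : (j : ℝ) + 1 ≤ k₀ := by exact_mod_cast hlt
      have him := hj
      rw [Metric.mem_closedBall, dist_eq_norm] at him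
      have him := (abs_le.1 ((Complex.abs_im_le_norm _).trans him)).2
      rw [Complex.sub_im, oddPiI_im] at him
      have := abs_nonneg (max V (max W₁ W₂))
      nlinarith
    obtain ⟨l, hl⟩ := Int.le.dest hjk
    refine ⟨l, ?_⟩
    have hjl : j = (l + k₀ : ℕ) := by rw [← hl]; push_cast; ring
    rw [hjl] at hj
    exact zero_near_unique hd (hsmall l) hj (hω l) hw0 (hω0 l)

end Local

/-! ### Large zeros lie in disjoint half-strips normal to the edges. -/

section Localisation

variable {R : ℕ} {δ γ : Fin R → ℂ}

lemma norm_cexp_mul_conj (z g : ℂ) :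
    ‖Complex.exp (z * (starRingEnd ℂ) g)‖ = Real.exp (planePair z g) := by
  rw [Complex.norm_exp, re_mul_conj]

/-- At a zero, no term of the sum can dominate all the others. -/
lemma IsGeneric.exists_dominance_const (hg : IsGeneric δ γ) :
    ∃ C : ℝ, 0 < C ∧ ∀ z, expSum δ γ z = 0 → ∀ a, (∀ r, planePair z (γ r) ≤ planePair z (γ a)) →
      ∃ b, b ≠ a ∧ planePair z (γ a) ≤ planePair z (γ b) + C := by
  classical
  have hlim : Tendsto (fun C : ℝ => (∑ r, ‖δ r‖) * Real.exp (-C)) atTop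
      (nhds ((∑ r, ‖δ r‖) * 0)) :=
    Tendsto.const_mul _ (Real.tendsto_exp_atBot.comp tendsto_neg_atTop_atBot)
  rw [mul_zero] at hlim
  -- If all other exponents were more than `C` below, their total would be at most (Σ|δ_r|) exp(-C)
  -- times the leading exponential, less than the leading term.
  have hall : ∀ᶠ C : ℝ in atTop, ∀ a, (∑ r, ‖δ r‖) * Real.exp (-C) < ‖δ a‖ :=
    eventually_all.2 fun a => hlim.eventually (gt_mem_nhds (norm_pos_iff.2 (hg.coeff_ne_zero a)))
  obtain ⟨C, hC, hC0⟩ := (hall.and (eventually_gt_atTop 0)).exists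
  refine ⟨C, hC0, fun z hz a ha => ?_⟩
  by_contra! hlt
  rw [expSum, ← Finset.add_sum_erase _ _ (Finset.mem_univ a)] at hz
  have h1 : ‖δ a‖ * Real.exp (planePair z (γ a)) ≤
      ∑ r ∈ Finset.univ.erase a, ‖δ r‖ * Real.exp (planePair z (γ a) + -C) := by
    rw [← norm_cexp_mul_conj, ← norm_mul, eq_neg_of_add_eq_zero_left hz, norm_neg]
    refine (norm_sum_le _ _).trans (Finset.sum_le_sum fun r hr => ?_)
    rw [norm_mul, norm_cexp_mul_conj]
    have := hlt r (Finset.ne_of_mem_erase hr)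
    gcongr
    linarith
  have h2 : ∑ r ∈ Finset.univ.erase a, ‖δ r‖ * Real.exp (planePair z (γ a) + -C) ≤
      (∑ r, ‖δ r‖) * Real.exp (-C) * Real.exp (planePair z (γ a)) := by
    rw [← Finset.sum_mul, Real.exp_add, mul_assoc, mul_comm (Real.exp (-C))]
    gcongr
    exact Finset.erase_subset _ _
  have h3 := mul_lt_mul_of_pos_right (hC a) (Real.exp_pos (planePair z (γ a)))
  linarith

lemma planePair_real_smul (t : ℝ) (z g : ℂ) : planePair (t • z) g = t * planePair z g := by
  simp [planePair]; ring

lemma continuous_planePair (g : ℂ) : Continuous fun z => planePair z g := by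
  unfold planePair; fun_prop

/-- The maximum over all exponents minus the minimum over the three is continuous and positively
homogeneous of degree one. On the unit circle it is positive because three exponents cannot all be
maximal; its minimum there is the constant. -/
lemma IsGeneric.exists_gap_of_ne (hg : IsGeneric δ γ) {a b d : Fin R} (hab : a ≠ b) (had : a ≠ d)
    (hbd : b ≠ d) : ∃ c : ℝ, 0 < c ∧ ∀ z : ℂ, ∃ r,
      min (planePair z (γ a)) (min (planePair z (γ b)) (planePair z (γ d))) + c * ‖z‖
        ≤ planePair z (γ r) := by
  classical
  have hne : (Finset.univ : Finset (Fin R)).Nonempty := ⟨a, Finset.mem_univ a⟩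
  set φ : ℂ → ℝ := fun z => Finset.univ.sup' hne (fun r => planePair z (γ r)) -
    min (planePair z (γ a)) (min (planePair z (γ b)) (planePair z (γ d))) with hφ
  have hcont : Continuous φ := by
    refine Continuous.sub (Continuous.finset_sup'_apply hne fun r _ => continuous_planePair (γ r)) ?_
    exact (continuous_planePair _).min ((continuous_planePair _).min (continuous_planePair _))
  have hpos : ∀ u ∈ Metric.sphere (0 : ℂ) 1, 0 < φ u := by
    intro u hu
    have hu0 : u ≠ 0 := by
      rintro rfl; simp at hu
    by_contra! hle
    have hle' : ∀ r, planePair u (γ r) ≤ Finset.univ.sup' hne (fun r => planePair u (γ r)) :=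
      fun r => Finset.le_sup' (fun r => planePair u (γ r)) (Finset.mem_univ r)
    have hmin : Finset.univ.sup' hne (fun r => planePair u (γ r)) ≤
        min (planePair u (γ a)) (min (planePair u (γ b)) (planePair u (γ d))) := by
      simpa [hφ] using hle
    obtain ⟨h1, h2⟩ := le_min_iff.1 hmin
    obtain ⟨h2, h3⟩ := le_min_iff.1 h2
    exact hg.not_three_maximizers hu0 hle' hab had hbd (le_antisymm (hle' _) h1)
      (le_antisymm (hle' _) h2) (le_antisymm (hle' _) h3)
  obtain ⟨u₀, hu₀, hmin⟩ := (isCompact_sphere (0 : ℂ) 1).exists_isMinOn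
    ⟨1, by simp⟩ hcont.continuousOn
  refine ⟨φ u₀, hpos _ hu₀, fun z => ?_⟩
  by_cases hz : z = 0
  · exact ⟨a, by simp [hz, planePair]⟩
  set u : ℂ := ‖z‖⁻¹ • z with hu
  have hzn : 0 < ‖z‖ := norm_pos_iff.2 hz
  have hzu : z = ‖z‖ • u := by rw [hu, smul_smul, mul_inv_cancel₀ hzn.ne', one_smul]
  have hus : u ∈ Metric.sphere (0 : ℂ) 1 := by
    rw [mem_sphere_zero_iff_norm, hu, norm_smul, norm_inv, norm_norm, inv_mul_cancel₀ hzn.ne']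
  obtain ⟨r, -, hr⟩ := Finset.exists_mem_eq_sup' hne (fun r => planePair u (γ r))
  refine ⟨r, ?_⟩
  have h1 : φ u₀ ≤ φ u := hmin hus
  simp only [hφ] at h1
  rw [hr] at h1
  have h2 : ∀ g, planePair z g = ‖z‖ * planePair u g := by
    intro g; rw [← planePair_real_smul, ← hzu]
  rw [h2, h2, h2, h2, ← mul_min_of_nonneg _ _ hzn.le, ← mul_min_of_nonneg _ _ hzn.le,
    mul_comm _ ‖z‖, ← mul_add]
  refine mul_le_mul_of_nonneg_left ?_ hzn.le
  simp only [hφ]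
  linarith

/-- Of any three exponents, one is at least linearly below the maximum. -/
lemma IsGeneric.exists_gap (hg : IsGeneric δ γ) : ∃ c : ℝ, 0 < c ∧ ∀ (a b d : Fin R), a ≠ b →
    a ≠ d → b ≠ d → ∀ z : ℂ, ∃ r,
      min (planePair z (γ a)) (min (planePair z (γ b)) (planePair z (γ d))) + c * ‖z‖
        ≤ planePair z (γ r) := by
  have : ∀ᶠ c : ℝ in nhdsWithin 0 (Set.Ioi 0), ∀ (a b d : Fin R), a ≠ b →
    a ≠ d → b ≠ d → ∀ z : ℂ, ∃ r,
      min (planePair z (γ a)) (min (planePair z (γ b)) (planePair z (γ d))) + c * ‖z‖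
        ≤ planePair z (γ r) := by
    simp only [eventually_all]
    intro a b d hab had hbd
    obtain ⟨c, hc, H⟩ := hg.exists_gap_of_ne hab had hbd
    filter_upwards [Ioo_mem_nhdsGT hc] with c' hc' z
    obtain ⟨r, hr⟩ := H z
    refine ⟨r, le_trans ?_ hr⟩
    gcongr
    exact hc'.2.le
  obtain ⟨c, hc, hpos⟩ := (this.and self_mem_nhdsWithin).exists
  exact ⟨c, hpos, hc⟩

lemma exists_edge_length_bounds (hinj : Function.Injective γ) : ∃ l D : ℝ, 0 < l ∧
    (∀ a b, a ≠ b → l ≤ ‖γ b - γ a‖) ∧ ∀ a b, ‖γ b - γ a‖ ≤ D := by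
  have h1 : ∀ᶠ l : ℝ in nhdsWithin 0 (Set.Ioi 0), ∀ a b, a ≠ b → l ≤ ‖γ b - γ a‖ := by
    simp only [eventually_all]
    intro a b hab
    filter_upwards [Ioo_mem_nhdsGT (norm_pos_iff.2 (sub_ne_zero.2 fun h => hab (hinj h.symm)))]
      with l hl using hl.2.le
  have h2 : ∀ᶠ D : ℝ in atTop, ∀ a b, ‖γ b - γ a‖ ≤ D := by
    simp only [eventually_all]
    exact fun a b => eventually_ge_atTop _
  obtain ⟨l, hl, hl0⟩ := (h1.and self_mem_nhdsWithin).exists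
  obtain ⟨D, hD⟩ := h2.exists
  exact ⟨l, D, hl0, hl, hD⟩

/-- Comparison of an exponent with an edge, in terms of the coordinate along the edge. -/
lemma planePair_sub_mul_sq (z x d : ℂ) :
    planePair z x * ‖d‖ ^ 2 = (z * (starRingEnd ℂ) d).re * ((starRingEnd ℂ) x * d).re -
      (z * (starRingEnd ℂ) d).im * ((starRingEnd ℂ) x * d).im := by
  rw [Complex.sq_norm, Complex.normSq_apply]
  simp [planePair]; ring

lemma eventually_lt_mul {c : ℝ} (hc : 0 < c) (A : ℝ) : ∀ᶠ t : ℝ in atTop, A < c * t :=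
  (tendsto_id.const_mul_atTop hc).eventually_gt_atTop A

lemma norm_conj_mul_le {x d : ℂ} {D : ℝ} (hx : ‖x‖ ≤ D) (hd : ‖d‖ ≤ D) :
    ‖(starRingEnd ℂ) x * d‖ ≤ D ^ 2 := by
  rw [norm_mul, RCLike.norm_conj, sq]
  exact mul_le_mul hx hd (norm_nonneg _) ((norm_nonneg _).trans hx)

/-- Large zeros lie close to the normal direction of an edge. -/
lemma IsGeneric.exists_edge_of_zero (hg : IsGeneric δ γ) : ∃ C : ℝ, ∀ V : ℝ, ∃ E₀ : ℝ, ∀ z : ℂ,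
    E₀ ≤ ‖z‖ → expSum δ γ z = 0 → ∃ a b, IsEdge γ (a, b) ∧
      |(z * (starRingEnd ℂ) (γ b - γ a)).re| ≤ C ∧ V ≤ (z * (starRingEnd ℂ) (γ b - γ a)).im := by
  classical
  obtain ⟨C, hC0, hdom⟩ := hg.exists_dominance_const
  obtain ⟨c, hc, hgap⟩ := hg.exists_gap
  obtain ⟨l, D, hl, hlmin, hD⟩ := exists_edge_length_bounds hg.injective
  refine ⟨C, fun V => ?_⟩
  have hlc : 0 < l ^ 2 * c := by positivity
  -- The three bounds serve in turn to make any third exponent fall below the two competing ones, to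
  -- push the imaginary part beyond `V`, and to place the third exponent strictly on the correct
  -- side of the edge.
  obtain ⟨E₀, hE₀⟩ := eventually_atTop.1 ((eventually_lt_mul hc C).and
    ((eventually_lt_mul hl (|V| + C)).and (eventually_lt_mul hlc (C * D ^ 2 + C * l ^ 2))))
  refine ⟨E₀, fun z hzE hz => ?_⟩
  obtain ⟨h1, h2, h3⟩ := hE₀ _ hzE
  have hne : Nonempty (Fin R) := ⟨⟨0, by have := hg.two_le; omega⟩⟩
  -- Two terms within `C` of the maximum and of each other form an edge, once oriented properly.
  have key : ∀ a b, a ≠ b → (∀ r, planePair z (γ r) ≤ planePair z (γ a) + C) →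
      (∀ r, planePair z (γ r) ≤ planePair z (γ b) + C) →
      0 ≤ (z * (starRingEnd ℂ) (γ b - γ a)).im →
      IsEdge γ (a, b) ∧ |(z * (starRingEnd ℂ) (γ b - γ a)).re| ≤ C ∧
        V ≤ (z * (starRingEnd ℂ) (γ b - γ a)).im := by
    intro a b hab ha hb him
    have hre : |(z * (starRingEnd ℂ) (γ b - γ a)).re| ≤ C := by
      rw [re_mul_conj, planePair_sub, abs_le]
      constructor <;> linarith [ha b, hb a]
    have hnorm : |V| + C < ‖z * (starRingEnd ℂ) (γ b - γ a)‖ := by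
      rw [norm_mul, RCLike.norm_conj, mul_comm]
      exact h2.trans_le (by gcongr; exact hlmin a b hab)
    have him' : |V| ≤ (z * (starRingEnd ℂ) (γ b - γ a)).im := by
      have := Complex.norm_le_abs_re_add_abs_im (z * (starRingEnd ℂ) (γ b - γ a))
      rw [abs_of_nonneg him] at this
      linarith
    refine ⟨⟨hab, fun d hda hdb => ?_⟩, hre, (le_abs_self V).trans him'⟩
    obtain ⟨r, hr⟩ := hgap a b d hab hda.symm hdb.symm z
    -- The low exponent of the triple can be neither `a` nor `b`, which are within `C < c * ‖z‖` of
    -- the maximum.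
    have hd : planePair z (γ d) + c * ‖z‖ ≤ planePair z (γ a) + C := by
      rcases min_choice (planePair z (γ a)) (min (planePair z (γ b)) (planePair z (γ d)))
        with hm | hm
      · rw [hm] at hr; linarith [ha r]
      rcases min_choice (planePair z (γ b)) (planePair z (γ d)) with hm' | hm'
      · rw [hm, hm'] at hr; linarith [hb r]
      · rw [hm, hm'] at hr; linarith [ha r]
    have hid := planePair_sub_mul_sq z (γ d - γ a) (γ b - γ a)
    rw [planePair_sub] at hid
    set y := z * (starRingEnd ℂ) (γ b - γ a)
    set q := (starRingEnd ℂ) (γ d - γ a) * (γ b - γ a)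
    have hq : ‖q‖ ≤ D ^ 2 := norm_conj_mul_le (hD _ _) (hD _ _)
    have h4 : -(C * D ^ 2) ≤ y.re * q.re := by
      have : |y.re * q.re| ≤ C * D ^ 2 := by
        rw [abs_mul]
        exact mul_le_mul hre ((Complex.abs_re_le_norm _).trans hq) (abs_nonneg _) hC0.le
      exact (abs_le.1 this).1
    have h5 : (planePair z (γ d) - planePair z (γ a)) * ‖γ b - γ a‖ ^ 2 ≤
        -((c * ‖z‖ - C) * l ^ 2) := by
      have h6 : (c * ‖z‖ - C) * l ^ 2 ≤ (c * ‖z‖ - C) * ‖γ b - γ a‖ ^ 2 := by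
        have := hlmin a b hab
        have : 0 ≤ c * ‖z‖ - C := by linarith
        gcongr
      nlinarith [sq_nonneg ‖γ b - γ a‖]
    have h7 : 0 < y.im * q.im := by nlinarith
    exact pos_of_mul_pos_right h7 him
  obtain ⟨a, ha⟩ := Finite.exists_max fun r => planePair z (γ r)
  obtain ⟨b, hba, hb⟩ := hdom z hz a ha
  have ha' : ∀ r, planePair z (γ r) ≤ planePair z (γ a) + C := fun r => by linarith [ha r]
  have hb' : ∀ r, planePair z (γ r) ≤ planePair z (γ b) + C := fun r => by linarith [ha r]
  rcases le_total 0 (z * (starRingEnd ℂ) (γ b - γ a)).im with h | h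
  · exact ⟨a, b, key a b hba.symm ha' hb' h⟩
  · refine ⟨b, a, key b a hba hb' ha' ?_⟩
    rw [← neg_sub, map_neg, mul_neg, Complex.neg_im]
    linarith

/-- Far out, the strips around the normals of different edges are disjoint. -/
lemma exists_edge_separation (hinj : Function.Injective γ) {C : ℝ} (hC : 0 ≤ C) :
    ∃ V : ℝ, ∀ (z : ℂ) (e e' : Fin R × Fin R), IsEdge γ e → IsEdge γ e' →
      |(z * (starRingEnd ℂ) (γ e.2 - γ e.1)).re| ≤ C →
      V ≤ (z * (starRingEnd ℂ) (γ e.2 - γ e.1)).im →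
      |(z * (starRingEnd ℂ) (γ e'.2 - γ e'.1)).re| ≤ C →
      V ≤ (z * (starRingEnd ℂ) (γ e'.2 - γ e'.1)).im → e = e' := by
  obtain ⟨l, D, hl, hlmin, hD⟩ := exists_edge_length_bounds hinj
  have hev : ∀ᶠ V : ℝ in atTop, ∀ e, IsEdge γ e → ∀ d, d ≠ e.1 → d ≠ e.2 →
      C * D ^ 2 + (2 * C + 1) * D ^ 2 < ((starRingEnd ℂ) (γ d - γ e.1) * (γ e.2 - γ e.1)).im * V := by
    simp only [eventually_all]
    exact fun e he d h1 h2 => eventually_lt_mul (he.2 d h1 h2) _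
  obtain ⟨V, hV, hV0⟩ := (hev.and (eventually_gt_atTop 0)).exists
  -- Beyond height `V` the exponents off the edge lie more than `2 * C + 1` below its first end
  -- point. So the end points of `e` are the only candidates for those of `e'`, and conversely.
  have low : ∀ (z : ℂ) (e : Fin R × Fin R), IsEdge γ e →
      |(z * (starRingEnd ℂ) (γ e.2 - γ e.1)).re| ≤ C →
      V ≤ (z * (starRingEnd ℂ) (γ e.2 - γ e.1)).im → ∀ d, d ≠ e.1 → d ≠ e.2 →
      planePair z (γ d) + (2 * C + 1) < planePair z (γ e.1) := by
    intro z e he hre him d h1 h2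
    have hv := hV e he d h1 h2
    have hpos := he.2 d h1 h2
    have hid := planePair_sub_mul_sq z (γ d - γ e.1) (γ e.2 - γ e.1)
    rw [planePair_sub] at hid
    have hlen : ‖γ e.2 - γ e.1‖ ≤ D := hD _ _
    have hlen0 : 0 < ‖γ e.2 - γ e.1‖ := hl.trans_le (hlmin _ _ he.1)
    set y := z * (starRingEnd ℂ) (γ e.2 - γ e.1)
    set q := (starRingEnd ℂ) (γ d - γ e.1) * (γ e.2 - γ e.1)
    have hq : ‖q‖ ≤ D ^ 2 := norm_conj_mul_le (hD _ _) (hD _ _)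
    have h4 : y.re * q.re ≤ C * D ^ 2 := by
      refine (le_abs_self _).trans ?_
      rw [abs_mul]
      exact mul_le_mul hre ((Complex.abs_re_le_norm _).trans hq) (abs_nonneg _) hC
    have h5 : q.im * V ≤ y.im * q.im := by rw [mul_comm]; gcongr
    have h6 : (2 * C + 1) * ‖γ e.2 - γ e.1‖ ^ 2 ≤ (2 * C + 1) * D ^ 2 := by gcongr
    have h7 : (planePair z (γ d) + (2 * C + 1) - planePair z (γ e.1)) * ‖γ e.2 - γ e.1‖ ^ 2 < 0 := by
      linarith
    have := neg_of_mul_neg_left h7 (by positivity)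
    linarith
  refine ⟨V, fun z e e' he he' hre him hre' him' => ?_⟩
  have hl1 := low z e he hre him
  have hl2 := low z e' he' hre' him'
  rw [re_mul_conj, planePair_sub, abs_le] at hre hre'
  have hup : ∀ r, planePair z (γ r) ≤ planePair z (γ e.1) + C := by
    intro r
    by_cases h1 : r = e.1
    · rw [h1]; linarith
    by_cases h2 : r = e.2
    · rw [h2]; linarith
    linarith [hl1 r h1 h2]
  have hmem : ∀ r, planePair z (γ e.1) - C ≤ planePair z (γ r) → r = e'.1 ∨ r = e'.2 := by
    intro r hr
    by_contra! hne
    linarith [hl2 r hne.1 hne.2, hup e'.1]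
  have m1 := hmem e.1 (by linarith)
  have m2 := hmem e.2 (by linarith)
  have hne := he.1
  rcases m1 with m1 | m1 <;> rcases m2 with m2 | m2
  · exact absurd (m1.trans m2.symm) hne
  · exact Prod.ext m1 m2
  -- Reversing the edge flips the sign of the imaginary part, which is positive for both.
  · exfalso
    rw [m1, m2, ← neg_sub, map_neg, mul_neg, Complex.neg_im] at him
    linarith
  · exact absurd (m1.trans m2.symm) hne

end Localisation

/-! ### One sequence of simple zeros for each edge. -/

section Zeros

variable {R : ℕ} {δ γ : Fin R → ℂ}

lemma oddPiI_norm_sub_le {k k₀ : ℕ} {w : ℂ}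
    (hw : w ∈ Metric.closedBall (oddPiI (k + k₀ : ℕ)) (1 / 8)) :
    |‖w‖ - 2 * Real.pi * k| ≤ (2 * k₀ + 1) * Real.pi + 1 / 8 := by
  rw [Metric.mem_closedBall, dist_eq_norm] at hw
  have h1 := (abs_norm_sub_norm_le w (oddPiI (k + k₀ : ℕ))).trans hw
  have h2 : ‖oddPiI (k + k₀ : ℕ)‖ = (2 * (k + k₀ : ℕ) + 1) * Real.pi := by
    have : oddPiI (k + k₀ : ℕ) = (((2 * (k + k₀ : ℕ) + 1) * Real.pi : ℝ) : ℂ) * Complex.I := by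
      simp [oddPiI]
    rw [this, norm_mul, Complex.norm_I, mul_one, Complex.norm_real, Real.norm_of_nonneg]
    have := Real.pi_pos
    positivity
  rw [h2] at h1
  push_cast at h1
  rw [abs_le] at h1 ⊢
  have : (0 : ℝ) ≤ (2 * k₀ + 1) * Real.pi := by have := Real.pi_pos; positivity
  constructor <;> nlinarith

lemma oddPiI_injective_of_near {k l k₀ : ℕ} {w : ℂ}
    (hk : w ∈ Metric.closedBall (oddPiI (k + k₀ : ℕ)) (1 / 8))
    (hl : w ∈ Metric.closedBall (oddPiI (l + k₀ : ℕ)) (1 / 8)) : k = l := by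
  rw [Metric.mem_closedBall, dist_eq_norm] at hk hl
  have h1 := abs_le.1 ((Complex.abs_im_le_norm _).trans hk)
  have h2 := abs_le.1 ((Complex.abs_im_le_norm _).trans hl)
  rw [Complex.sub_im, oddPiI_im] at h1 h2
  push_cast at h1 h2
  have hpi := Real.pi_gt_three
  rcases lt_trichotomy k l with h | h | h
  · have : (k : ℝ) + 1 ≤ l := by exact_mod_cast h
    nlinarith
  · exact h
  · have : (l : ℝ) + 1 ≤ k := by exact_mod_cast h
    nlinarith

/-- The exponential sum in the coordinate `w` adapted to an edge. -/
lemma expSum_eq_edge_normal_form (hδ : ∀ r, δ r ≠ 0) (hinj : Function.Injective γ) {a b : Fin R}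
    (hab : a ≠ b) (z : ℂ) :
    expSum δ γ z = δ a * Complex.exp (z * (starRingEnd ℂ) (γ a)) *
      (1 + Complex.exp (z * (starRingEnd ℂ) (γ b - γ a) + Complex.log (δ b / δ a)) +
        ∑ c ∈ (Finset.univ.erase a).erase b,
          (δ c / δ a * Complex.exp (-(Complex.log (δ b / δ a) *
            ((starRingEnd ℂ) (γ c - γ a) / (starRingEnd ℂ) (γ b - γ a))))) *
          Complex.exp ((z * (starRingEnd ℂ) (γ b - γ a) + Complex.log (δ b / δ a)) *
            ((starRingEnd ℂ) (γ c - γ a) / (starRingEnd ℂ) (γ b - γ a)))) := by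
  have hba : b ∈ Finset.univ.erase a := Finset.mem_erase.2 ⟨hab.symm, Finset.mem_univ _⟩
  have hζ : (starRingEnd ℂ) (γ b - γ a) ≠ 0 :=
    (map_ne_zero _).2 (sub_ne_zero.2 fun h => hab (hinj h.symm))
  rw [expSum, ← Finset.add_sum_erase _ _ (Finset.mem_univ a), ← Finset.add_sum_erase _ _ hba,
    mul_add, mul_add, mul_one, add_assoc, Finset.mul_sum]
  congr 2
  · rw [Complex.exp_add, Complex.exp_log (div_ne_zero (hδ b) (hδ a)),
      show z * (starRingEnd ℂ) (γ b) = z * (starRingEnd ℂ) (γ a) +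
        z * (starRingEnd ℂ) (γ b - γ a) by rw [map_sub]; ring, Complex.exp_add]
    field_simp [hδ a]
  · refine Finset.sum_congr rfl fun c _ => ?_
    rw [show z * (starRingEnd ℂ) (γ c) = z * (starRingEnd ℂ) (γ a) +
        (-(Complex.log (δ b / δ a) *
            ((starRingEnd ℂ) (γ c - γ a) / (starRingEnd ℂ) (γ b - γ a))) +
          (z * (starRingEnd ℂ) (γ b - γ a) + Complex.log (δ b / δ a)) *
            ((starRingEnd ℂ) (γ c - γ a) / (starRingEnd ℂ) (γ b - γ a))) by
        field_simp
        rw [map_sub, map_sub]; ring, Complex.exp_add, Complex.exp_add]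
    have := hδ a
    field_simp

/-- The quotient equals x̄d/|d|². Thus the side condition in `IsEdge` is what makes the remaining
exponentials decay upwards in the strip. -/
lemma im_conj_div_conj_pos {x d : ℂ} (hd : d ≠ 0) (h : 0 < ((starRingEnd ℂ) x * d).im) :
    0 < ((starRingEnd ℂ) x / (starRingEnd ℂ) d).im := by
  have : (starRingEnd ℂ) x / (starRingEnd ℂ) d = (starRingEnd ℂ) x * d / (Complex.normSq d : ℝ) := by
    have h1 : (starRingEnd ℂ) d ≠ 0 := (map_ne_zero _).2 hd
    rw [← Complex.mul_conj]
    field_simp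
  rw [this, Complex.div_ofReal_im]
  exact div_pos h (Complex.normSq_pos.2 hd)

/-- The zeros belonging to an edge, far out, form a sequence of simple zeros with asymptotically
constant spacing. -/
lemma IsGeneric.exists_zero_sequence_of_edge (hg : IsGeneric δ γ) {a b : Fin R}
    (h : IsEdge γ (a, b)) {C : ℝ} (hC : 1 + ‖Complex.log (δ b / δ a)‖ ≤ C) (V : ℝ) :
    ∃ (V' B : ℝ) (Z : ℕ → ℂ), Function.Injective Z ∧ (∀ k, expSum δ γ (Z k) = 0) ∧
      (∀ k, deriv (expSum δ γ) (Z k) ≠ 0) ∧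
      (∀ k, |(Z k * (starRingEnd ℂ) (γ b - γ a)).re| ≤ C) ∧
      (∀ k, V ≤ (Z k * (starRingEnd ℂ) (γ b - γ a)).im) ∧
      (∀ k : ℕ, |‖γ b - γ a‖ * ‖Z k‖ - 2 * Real.pi * k| ≤ B) ∧
      ∀ z, |(z * (starRingEnd ℂ) (γ b - γ a)).re| ≤ C →
        V' ≤ (z * (starRingEnd ℂ) (γ b - γ a)).im → expSum δ γ z = 0 → ∃ k, z = Z k := by
  have hab : a ≠ b := h.1
  have hd : γ b - γ a ≠ 0 := sub_ne_zero.2 fun h => hab (hg.injective h.symm)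
  set lam := Complex.log (δ b / δ a) with hlam
  set ζ := (starRingEnd ℂ) (γ b - γ a) with hζdef
  have hζ : ζ ≠ 0 := (map_ne_zero _).2 hd
  have hζn : ‖ζ‖ = ‖γ b - γ a‖ := RCLike.norm_conj _
  set s := (Finset.univ.erase a).erase b with hs
  set μ : Fin R → ℂ := fun c => (starRingEnd ℂ) (γ c - γ a) / ζ with hμ
  set β : Fin R → ℂ := fun c => δ c / δ a * Complex.exp (-(lam * μ c)) with hβ
  have hμpos : ∀ c ∈ s, 0 < (μ c).im := by
    intro c hc
    have hcb := Finset.ne_of_mem_erase hc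
    have hca := Finset.ne_of_mem_erase (Finset.mem_of_mem_erase hc)
    exact im_conj_div_conj_pos hd (h.2 c hca hcb)
  have hl := Complex.abs_re_le_norm lam
  have hl' := Complex.abs_im_le_norm lam
  have hnf : ∀ z, expSum δ γ z = δ a * Complex.exp (z * (starRingEnd ℂ) (γ a)) *
      (1 + Complex.exp (z * ζ + lam) + ∑ c ∈ s, β c * Complex.exp ((z * ζ + lam) * μ c)) :=
    fun z => expSum_eq_edge_normal_form hg.coeff_ne_zero hg.injective hab z
  have hpre : ∀ z, δ a * Complex.exp (z * (starRingEnd ℂ) (γ a)) ≠ 0 := fun z =>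
    mul_ne_zero (hg.coeff_ne_zero a) (Complex.exp_ne_zero _)
  -- The shift by `lam` costs at most `‖lam‖ ≤ C` in each coordinate: hence the doubled width and
  -- the raised height.
  obtain ⟨k₀, W, ω, hω0, hω1, hωre, hωim, hωb, hωall⟩ :=
    exists_zero_sequence s β μ hμpos (C := C + C) (by linarith [norm_nonneg lam]) (V + ‖lam‖)
  have hZ : ∀ k, (ω k - lam) / ζ * ζ + lam = ω k := fun k => by field_simp; ring
  have hZ' : ∀ k, (ω k - lam) / ζ * ζ = ω k - lam := fun k => by field_simp
  refine ⟨W + ‖lam‖, (2 * k₀ + 1) * Real.pi + 1 / 8 + ‖lam‖, fun k => (ω k - lam) / ζ,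
    ?_, ?_, ?_, ?_, ?_, ?_, ?_⟩
  · intro k l hkl
    have : ω k = ω l := by rw [← hZ k, ← hZ l]; simp only at hkl; rw [hkl]
    have h2 := hωb l
    rw [← this] at h2
    exact oddPiI_injective_of_near (hωb k) h2
  · intro k
    rw [hnf, hZ, hω0, mul_zero]
  · intro k
    set z := (ω k - lam) / ζ with hz
    have hlin : HasDerivAt (fun z => z * ζ + lam) ζ z := by
      simpa using ((hasDerivAt_id z).mul_const ζ).add_const lam
    have hG : HasDerivAt (fun z => 1 + Complex.exp (z * ζ + lam) +
        ∑ c ∈ s, β c * Complex.exp ((z * ζ + lam) * μ c))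
        ((Complex.exp (ω k) + ∑ c ∈ s, β c * μ c * Complex.exp (ω k * μ c)) * ζ) z := by
      have h1 := (hlin.cexp.const_add 1).add (HasDerivAt.fun_sum (u := s) fun c _ =>
        ((hlin.mul_const (μ c)).cexp).const_mul (β c))
      refine h1.congr_deriv ?_
      rw [hZ k, add_mul, Finset.sum_mul]
      congr 1
      exact Finset.sum_congr rfl fun c _ => by ring
    have hA : HasDerivAt (fun z => δ a * Complex.exp (z * (starRingEnd ℂ) (γ a)))
        (δ a * (Complex.exp (z * (starRingEnd ℂ) (γ a)) * (starRingEnd ℂ) (γ a))) z := by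
      simpa using (((hasDerivAt_id z).mul_const ((starRingEnd ℂ) (γ a))).cexp).const_mul (δ a)
    have hF := hA.mul hG
    have hFe : expSum δ γ = (fun z => δ a * Complex.exp (z * (starRingEnd ℂ) (γ a))) *
        (fun z => 1 + Complex.exp (z * ζ + lam) +
          ∑ c ∈ s, β c * Complex.exp ((z * ζ + lam) * μ c)) := funext hnf
    rw [hFe, hF.deriv, hZ, hω0, mul_zero, zero_add]
    exact mul_ne_zero (hpre z) (mul_ne_zero (hω1 k) hζ)
  · intro k
    simp only
    rw [hZ', Complex.sub_re]
    refine (abs_sub _ _).trans ?_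
    linarith [hωre k]
  · intro k
    simp only
    rw [hZ', Complex.sub_im]
    linarith [hωim k, (abs_le.1 hl').2]
  · intro k
    have h1 : ‖γ b - γ a‖ * ‖(ω k - lam) / ζ‖ = ‖ω k - lam‖ := by
      rw [← hζn, mul_comm, ← norm_mul, hZ']
    simp only
    rw [h1]
    have h2 := abs_le.1 (oddPiI_norm_sub_le (hωb k))
    have h3 := norm_sub_le (ω k) lam
    have h4 := norm_sub_norm_le (ω k) lam
    rw [abs_le]
    constructor <;> linarith
  · intro z hre him hz
    have h1 : 1 + Complex.exp (z * ζ + lam) +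
        ∑ c ∈ s, β c * Complex.exp ((z * ζ + lam) * μ c) = 0 := by
      rw [hnf] at hz
      exact (mul_eq_zero.1 hz).resolve_left (hpre z)
    obtain ⟨k, hk⟩ := hωall (z * ζ + lam) (by
      rw [Complex.add_re]
      refine (abs_add_le _ _).trans ?_
      linarith) (by
      rw [Complex.add_im]
      linarith [(abs_le.1 hl').1]) h1
    exact ⟨k, by simp only; rw [← hk]; field_simp; ring⟩

/-- Parametrisation of all large zeros by edges and natural numbers. -/
theorem IsGeneric.exists_zero_parametrisation (hg : IsGeneric δ γ) :
    ∃ (E₀ : ℝ) (B : Fin R × Fin R → ℝ) (Z : Fin R × Fin R → ℕ → ℂ),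
      (∀ e ∈ edgeSet γ, ∀ k, expSum δ γ (Z e k) = 0) ∧
      (∀ e ∈ edgeSet γ, ∀ k, deriv (expSum δ γ) (Z e k) ≠ 0) ∧
      (∀ e ∈ edgeSet γ, ∀ k : ℕ, |‖γ e.2 - γ e.1‖ * ‖Z e k‖ - 2 * Real.pi * k| ≤ B e) ∧
      (∀ e ∈ edgeSet γ, ∀ e' ∈ edgeSet γ, ∀ k k', Z e k = Z e' k' → e = e' ∧ k = k') ∧
      ∀ z, E₀ ≤ ‖z‖ → expSum δ γ z = 0 → ∃ e ∈ edgeSet γ, ∃ k, z = Z e k := by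
  obtain ⟨C₀, hC₀⟩ := hg.exists_edge_of_zero
  obtain ⟨C, hC, hC0, hC1⟩ : ∃ C : ℝ, (∀ a b, 1 + ‖Complex.log (δ b / δ a)‖ ≤ C) ∧ 0 ≤ C ∧
      C₀ ≤ C := by
    refine (Eventually.and (f := atTop) ?_ ((eventually_ge_atTop 0).and
      (eventually_ge_atTop C₀))).exists
    simp only [eventually_all]
    exact fun a b => eventually_ge_atTop _
  obtain ⟨V, hV⟩ := exists_edge_separation hg.injective hC0
  have hseq := fun (e : Fin R × Fin R) (he : IsEdge γ (e.1, e.2)) =>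
    hg.exists_zero_sequence_of_edge he (hC e.1 e.2) V
  have hseq' : ∀ e : Fin R × Fin R, ∃ (V' B : ℝ) (Z : ℕ → ℂ), IsEdge γ e →
      Function.Injective Z ∧ (∀ k, expSum δ γ (Z k) = 0) ∧
      (∀ k, deriv (expSum δ γ) (Z k) ≠ 0) ∧
      (∀ k, |(Z k * (starRingEnd ℂ) (γ e.2 - γ e.1)).re| ≤ C) ∧
      (∀ k, V ≤ (Z k * (starRingEnd ℂ) (γ e.2 - γ e.1)).im) ∧
      (∀ k : ℕ, |‖γ e.2 - γ e.1‖ * ‖Z k‖ - 2 * Real.pi * k| ≤ B) ∧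
      ∀ z, |(z * (starRingEnd ℂ) (γ e.2 - γ e.1)).re| ≤ C →
        V' ≤ (z * (starRingEnd ℂ) (γ e.2 - γ e.1)).im → expSum δ γ z = 0 → ∃ k, z = Z k := by
    intro e
    by_cases he : IsEdge γ e
    · obtain ⟨V', B, Z, H⟩ := hseq e he
      exact ⟨V', B, Z, fun _ => H⟩
    -- Pairs that are not edges get dummy data, so that the choice ranges over all pairs.
    · exact ⟨0, 0, 0, fun h => absurd h he⟩
  choose V' B Z H using hseq'
  obtain ⟨M, hM⟩ : ∃ M : ℝ, ∀ e, V' e ≤ M := by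
    refine (Eventually.exists (f := atTop) ?_)
    simp only [eventually_all]
    exact fun e => eventually_ge_atTop _
  -- The strip width `C₀` is independent of the height, so the height may be chosen after the
  -- sequences and their thresholds.
  obtain ⟨E₀, hE₀⟩ := hC₀ M
  refine ⟨E₀, B, Z, fun e he => (H e (mem_edgeSet.1 he)).2.1,
    fun e he => (H e (mem_edgeSet.1 he)).2.2.1, fun e he => (H e (mem_edgeSet.1 he)).2.2.2.2.2.1,
    fun e he e' he' k k' hkk => ?_, fun z hz hz0 => ?_⟩
  · have h1 := H e (mem_edgeSet.1 he)
    have h2 := H e' (mem_edgeSet.1 he')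
    have hee : e = e' := hV (Z e k) e e' (mem_edgeSet.1 he) (mem_edgeSet.1 he') (h1.2.2.2.1 k)
      (h1.2.2.2.2.1 k) (by rw [hkk]; exact h2.2.2.2.1 k') (by rw [hkk]; exact h2.2.2.2.2.1 k')
    subst hee
    exact ⟨rfl, h1.1 hkk⟩
  · obtain ⟨a, b, he, hre, him⟩ := hE₀ z hz hz0
    obtain ⟨k, hk⟩ := (H (a, b) he).2.2.2.2.2.2 z (hre.trans hC1) ((hM _).trans him) hz0
    exact ⟨(a, b), mem_edgeSet.2 he, k, hk⟩

end Zeros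

/-! ### From the zero sequences to the counting functions. -/

section Counting

/-- The index set is squeezed between two initial segments of ℕ whose lengths come from `(l * E ± B)
/ (2 * Real.pi)`; rounding costs the extra 1. -/
lemma abs_ncard_sub_le_of_linear {x : ℕ → ℝ} {l B : ℝ} (hl : 0 < l)
    (hx : ∀ k : ℕ, |l * x k - 2 * Real.pi * k| ≤ B) {E : ℝ} (hE : 0 ≤ l * E + B) :
    {k | x k ≤ E}.Finite ∧
      |({k | x k ≤ E}.ncard : ℝ) - l * E / (2 * Real.pi)| ≤ B / (2 * Real.pi) + 1 := by
  have hpi : 0 < 2 * Real.pi := by positivity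
  have hsub : {k | x k ≤ E} ⊆ (Finset.range (⌊(l * E + B) / (2 * Real.pi)⌋₊ + 1) : Set ℕ) := by
    intro k hk
    have hk : x k ≤ E := hk
    rw [Finset.coe_range, Set.mem_Iio, Nat.lt_succ_iff]
    refine Nat.le_floor ?_
    rw [le_div_iff₀ hpi]
    have := (abs_le.1 (hx k)).1
    nlinarith
  have hsup : (Finset.range ⌈(l * E - B) / (2 * Real.pi)⌉₊ : Set ℕ) ⊆ {k | x k ≤ E} := by
    intro k hk
    rw [Finset.coe_range, Set.mem_Iio, Nat.lt_ceil, lt_div_iff₀ hpi] at hk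
    have := (abs_le.1 (hx k)).2
    exact le_of_mul_le_mul_left (by linarith) hl
  have hfin := (Finset.finite_toSet _).subset hsub
  refine ⟨hfin, ?_⟩
  have h1 := Set.ncard_le_ncard hsub (Finset.finite_toSet _)
  have h2 := Set.ncard_le_ncard hsup hfin
  rw [Set.ncard_coe_finset, Finset.card_range] at h1 h2
  have h1' : ({k | x k ≤ E}.ncard : ℝ) ≤ (l * E + B) / (2 * Real.pi) + 1 := by
    have h3 := Nat.floor_le (div_nonneg hE hpi.le)
    have h4 : ({k | x k ≤ E}.ncard : ℝ) ≤ (⌊(l * E + B) / (2 * Real.pi)⌋₊ : ℝ) + 1 := by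
      exact_mod_cast h1
    linarith
  have h2' : (l * E - B) / (2 * Real.pi) ≤ ({k | x k ≤ E}.ncard : ℝ) :=
    (Nat.le_ceil _).trans (by exact_mod_cast h2)
  rw [add_div] at h1'
  rw [sub_div] at h2'
  rw [abs_le]
  constructor <;> linarith

/-- Counting a discrete set of the plane that is, up to a bounded part, a finite disjoint union of
sequences with asymptotically linear growth. -/
lemma isBigO_ncard_sub {ι : Type*} (s : Finset ι) (l B : ι → ℝ) (Z : ι → ℕ → ℂ)
    (hl : ∀ e ∈ s, 0 < l e)
    (hB : ∀ e ∈ s, ∀ k : ℕ, |l e * ‖Z e k‖ - 2 * Real.pi * k| ≤ B e)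
    (hinj : ∀ e ∈ s, ∀ e' ∈ s, ∀ k k', Z e k = Z e' k' → e = e' ∧ k = k')
    (S : ℝ → Set ℂ) (hfin : ∀ E, (S E).Finite) (E₀ : ℝ)
    (hsub : ∀ E, ∀ e ∈ s, ∀ k, ‖Z e k‖ ≤ E → Z e k ∈ S E)
    (hsup : ∀ E, ∀ z ∈ S E, z ∉ S E₀ → ∃ e ∈ s, ∃ k, ‖Z e k‖ ≤ E ∧ z = Z e k) :
    (fun E : ℝ => ((S E).ncard : ℝ) - (∑ e ∈ s, l e) * E / (2 * Real.pi)) =O[atTop]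
      (fun _ => (1 : ℝ)) := by
  classical
  have hpi : 0 < 2 * Real.pi := by positivity
  refine IsBigO.of_bound ((S E₀).ncard + ∑ e ∈ s, (B e / (2 * Real.pi) + 1)) ?_
  filter_upwards [eventually_ge_atTop 0] with E hE
  have hB0 : ∀ e ∈ s, 0 ≤ B e := fun e he => (abs_nonneg _).trans (hB e he 0)
  have hcount := fun e (he : e ∈ s) => abs_ncard_sub_le_of_linear (x := fun k => ‖Z e k‖) (hl e he)
    (hB e he) (E := E) (add_nonneg (mul_nonneg (hl e he).le hE) (hB0 e he))
  set K : ι → Finset ℕ := fun e =>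
    if h : {k | ‖Z e k‖ ≤ E}.Finite then h.toFinset else ∅ with hK
  have hKmem : ∀ e ∈ s, ∀ k, k ∈ K e ↔ ‖Z e k‖ ≤ E := by
    intro e he k
    simp [hK, (hcount e he).1]
  have hKcard : ∀ e ∈ s, {k | ‖Z e k‖ ≤ E}.ncard = (K e).card := by
    intro e he
    rw [← Set.ncard_coe_finset]
    congr 1
    ext k
    simpa using (hKmem e he k).symm
  set T : Finset ℂ := s.biUnion fun e => (K e).image (Z e) with hT
  have hTcard : T.card = ∑ e ∈ s, (K e).card := by
    rw [hT, Finset.card_biUnion]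
    · exact Finset.sum_congr rfl fun e he => Finset.card_image_of_injOn
        fun k _ k' _ hkk => (hinj e he e he k k' hkk).2
    · intro e he e' he' hne
      refine Finset.disjoint_left.2 fun z hz hz' => ?_
      obtain ⟨k, -, hk⟩ := Finset.mem_image.1 hz
      obtain ⟨k', -, hk'⟩ := Finset.mem_image.1 hz'
      exact hne (hinj e he e' he' k k' (hk.trans hk'.symm)).1
  have hTS : (T : Set ℂ) ⊆ S E := by
    intro z hz
    obtain ⟨e, he, hz⟩ := Finset.mem_biUnion.1 (Finset.mem_coe.1 hz)
    obtain ⟨k, hk, rfl⟩ := Finset.mem_image.1 hz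
    exact hsub E e he k ((hKmem e he k).1 hk)
  have hST : S E ⊆ S E₀ ∪ T := by
    intro z hz
    by_cases h0 : z ∈ S E₀
    · exact Or.inl h0
    · obtain ⟨e, he, k, hk, rfl⟩ := hsup E z hz h0
      exact Or.inr (Finset.mem_coe.2 (Finset.mem_biUnion.2
        ⟨e, he, Finset.mem_image.2 ⟨k, (hKmem e he k).2 hk, rfl⟩⟩))
  have h1 := Set.ncard_le_ncard hTS (hfin E)
  have h2 := (Set.ncard_le_ncard hST ((hfin E₀).union (Finset.finite_toSet _))).trans
    (Set.ncard_union_le _ _)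
  rw [Set.ncard_coe_finset] at h1 h2
  have h1' : (T.card : ℝ) ≤ (S E).ncard := by exact_mod_cast h1
  have h2' : ((S E).ncard : ℝ) ≤ (S E₀).ncard + T.card := by exact_mod_cast h2
  have h3 : |(T.card : ℝ) - (∑ e ∈ s, l e) * E / (2 * Real.pi)| ≤
      ∑ e ∈ s, (B e / (2 * Real.pi) + 1) := by
    rw [hTcard, Nat.cast_sum, Finset.sum_mul, Finset.sum_div, ← Finset.sum_sub_distrib]
    refine (Finset.abs_sum_le_sum_abs _ _).trans (Finset.sum_le_sum fun e he => ?_)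
    rw [← hKcard e he]
    exact (hcount e he).2
  rw [Real.norm_eq_abs, norm_one, mul_one]
  rw [abs_le] at h3 ⊢
  constructor <;> linarith

variable {R : ℕ} {δ γ : Fin R → ℂ}

lemma analyticOnNhd_expSum : AnalyticOnNhd ℂ (expSum δ γ) Set.univ := by
  intro z _
  unfold expSum
  fun_prop

/-- Were the sum identically zero, a point far out would be one of the parametrised zeros, where the
derivative does not vanish. -/
lemma IsGeneric.exists_expSum_ne_zero (hg : IsGeneric δ γ) : ∃ z, expSum δ γ z ≠ 0 := by
  by_contra! h
  obtain ⟨E₀, B, Z, -, hZ', -, -, hall⟩ := hg.exists_zero_parametrisation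
  obtain ⟨e, he, k, -⟩ := hall ((|E₀| : ℝ) : ℂ)
    (by rw [Complex.norm_real, Real.norm_eq_abs, abs_abs]; exact le_abs_self _) (h _)
  apply hZ' e he k
  rw [show expSum δ γ = fun _ => 0 from funext h]
  simp

/-- The zeros of a nontrivial exponential sum in a disc are finite in number. -/
lemma IsGeneric.finite_zerosIn (hg : IsGeneric δ γ) (E : ℝ) : (zerosIn (expSum δ γ) E).Finite := by
  by_contra hinf
  have hsub : zerosIn (expSum δ γ) E ⊆ Metric.closedBall 0 E := fun z hz => by simpa using hz.1
  obtain ⟨z, -, hz⟩ := Set.Infinite.exists_accPt_of_subset_isCompact hinf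
    (isCompact_closedBall (0 : ℂ) E) hsub
  obtain ⟨w, hw⟩ := hg.exists_expSum_ne_zero
  refine hw (analyticOnNhd_expSum.eqOn_zero_of_preconnected_of_frequently_eq_zero
    isPreconnected_univ (Set.mem_univ z) ?_ (Set.mem_univ w))
  exact (accPt_iff_frequently_nhdsNE.1 hz).mono fun y hy => hy.2

/-- The number of distinct zeros in a disc. -/
theorem IsGeneric.zeroCount_isBigO (hg : IsGeneric δ γ) :
    (fun E : ℝ => (zeroCount (expSum δ γ) E : ℝ) - perimeter (hull γ) * E / (2 * Real.pi))
      =O[atTop] (fun _ => (1 : ℝ)) := by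
  obtain ⟨E₀, B, Z, hZ, -, hB, hinj, hall⟩ := hg.exists_zero_parametrisation
  rw [hg.perimeter_eq]
  refine isBigO_ncard_sub (edgeSet γ) (fun e => ‖γ e.2 - γ e.1‖) B Z ?_ hB hinj
    (zerosIn (expSum δ γ)) hg.finite_zerosIn E₀ (fun E e he k hk => ⟨hk, hZ e he k⟩) ?_
  · intro e he
    exact norm_pos_iff.2 (sub_ne_zero.2 fun h => (mem_edgeSet.1 he).1 (hg.injective h.symm))
  · intro E z hz hz0
    have hE₀ : E₀ ≤ ‖z‖ := by
      by_contra! hlt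
      exact hz0 ⟨hlt.le, hz.2⟩
    obtain ⟨e, he, k, rfl⟩ := hall z hE₀ hz.2
    exact ⟨e, he, k, hz.1, rfl⟩

lemma IsGeneric.exists_simple_bound (hg : IsGeneric δ γ) : ∃ E₀ : ℝ, ∀ z, E₀ < ‖z‖ →
    expSum δ γ z = 0 → analyticOrderNatAt (expSum δ γ) z = 1 := by
  obtain ⟨E₀, B, Z, -, hZ', -, -, hall⟩ := hg.exists_zero_parametrisation
  refine ⟨E₀, fun z hz hz0 => ?_⟩
  obtain ⟨e, he, k, rfl⟩ := hall z hz.le hz0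
  rw [analyticOrderNatAt, (analyticOnNhd_expSum _
    (Set.mem_univ _)).analyticOrderAt_eq_one_of_zero_deriv_ne_zero hz0 (hZ' e he k)]
  rfl

/-- The number of zeros in a disc, counted with multiplicity. -/
theorem IsGeneric.zeroCountMult_isBigO (hg : IsGeneric δ γ) :
    (fun E : ℝ => (zeroCountMult (expSum δ γ) E : ℝ) - perimeter (hull γ) * E / (2 * Real.pi))
      =O[atTop] (fun _ => (1 : ℝ)) := by
  obtain ⟨E₀, hE₀⟩ := hg.exists_simple_bound
  set F := expSum δ γ with hF
  have hfin := hg.finite_zerosIn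
  -- Beyond `E₀` all zeros are simple, so the excess of the count with multiplicity no longer
  -- changes.
  have hdiff : ∀ E, E₀ ≤ E → (zeroCountMult F E : ℝ) =
      zeroCount F E + ((zeroCountMult F E₀ : ℝ) - zeroCount F E₀) := by
    intro E hE
    have hsub : zerosIn F E₀ ⊆ zerosIn F E := fun z hz => ⟨hz.1.trans hE, hz.2⟩
    have h1 : zeroCountMult F E = zeroCountMult F E₀ + (zerosIn F E \ zerosIn F E₀).ncard := by
      have hone : ∑ᶠ z ∈ zerosIn F E \ zerosIn F E₀, analyticOrderNatAt F z =
          (zerosIn F E \ zerosIn F E₀).ncard := by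
        rw [finsum_mem_eq_finite_toFinset_sum _ ((hfin E).subset Set.sdiff_subset),
          Set.ncard_eq_toFinset_card _ ((hfin E).subset Set.sdiff_subset), Finset.card_eq_sum_ones]
        refine Finset.sum_congr rfl fun z hz => ?_
        have hz := (Set.Finite.mem_toFinset _).1 hz
        refine hE₀ z ?_ hz.1.2
        by_contra! hle
        exact hz.2 ⟨hle, hz.1.2⟩
      rw [← hone, zeroCountMult, zeroCountMult,
        ← finsum_mem_union Set.disjoint_sdiff_right (hfin E₀) ((hfin E).subset Set.sdiff_subset),
        Set.union_sdiff_cancel hsub]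
    have h2 : (zerosIn F E \ zerosIn F E₀).ncard + (zerosIn F E₀).ncard = (zerosIn F E).ncard :=
      Set.ncard_sdiff_add_ncard_of_subset hsub (hfin E)
    rw [h1, zeroCount, zeroCount, ← h2]
    push_cast; ring
  have hconst : (fun _ : ℝ => (zeroCountMult F E₀ : ℝ) - zeroCount F E₀) =O[atTop]
      (fun _ => (1 : ℝ)) := isBigO_const_const _ one_ne_zero _
  refine (hg.zeroCount_isBigO.add hconst).congr' ?_ EventuallyEq.rfl
  filter_upwards [eventually_ge_atTop E₀] with E hE
  rw [hdiff E hE]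
  ring

end Counting

/-! ### The explicit fundamental solution. -/

section Propagator

variable {n m : ℕ}

/-- `B` is similar to a diagonal matrix. -/
def IsDiagonalisable (B : Matrix (Fin n) (Fin n) ℂ) : Prop :=
  ∃ (V : Matrix (Fin n) (Fin n) ℂ) (d : Fin n → ℂ), IsUnit V ∧ B = V * Matrix.diagonal d * V⁻¹

lemma IsDiagonalisable.inv {A : Matrix (Fin n) (Fin n) ℂ} (h : IsDiagonalisable A) :
    IsDiagonalisable A⁻¹ := by
  obtain ⟨V, d, hV, rfl⟩ := h
  -- `Ring.inverse d` is zero unless all entries are nonzero, in agreement with the inverse of a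
  -- singular matrix, so invertibility is not needed.
  refine ⟨V, Ring.inverse d, hV, ?_⟩
  rw [Matrix.mul_inv_rev, Matrix.mul_inv_rev, Matrix.nonsing_inv_nonsing_inv _
    ((Matrix.isUnit_iff_isUnit_det _).1 hV), Matrix.inv_diagonal, Matrix.mul_assoc]

lemma exp_smul_conj_diagonal {V : Matrix (Fin n) (Fin n) ℂ} (hV : IsUnit V) (d : Fin n → ℂ)
    (c : ℂ) : NormedSpace.exp (c • (V * Matrix.diagonal d * V⁻¹)) =
      V * Matrix.diagonal (fun i => Complex.exp (c * d i)) * V⁻¹ := by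
  have h1 : c • (V * Matrix.diagonal d * V⁻¹) = V * Matrix.diagonal (c • d) * V⁻¹ := by
    rw [Matrix.diagonal_smul, Matrix.mul_smul, Matrix.smul_mul]
  rw [h1, Matrix.exp_conj _ _ hV, Matrix.exp_diagonal]
  congr 3
  ext i
  rw [Pi.coe_exp, Complex.exp_eq_exp_ℂ]
  simp

lemma conj_diagonal_apply (V W : Matrix (Fin n) (Fin n) ℂ) (d : Fin n → ℂ) (i j : Fin n) :
    (V * Matrix.diagonal d * W) i j = ∑ k, V i k * d k * W k j := by
  rw [Matrix.mul_apply]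
  simp only [Matrix.mul_diagonal]

/-- In an eigenbasis every entry is a finite sum of scalar exponentials, so the derivative is
computed entry by entry without a norm on matrices. -/
lemma IsDiagonalisable.hasDerivAt_exp {B : Matrix (Fin n) (Fin n) ℂ} (h : IsDiagonalisable B)
    {c : ℝ → ℂ} {c' : ℂ} {x : ℝ} (hc : HasDerivAt c c' x) (i j : Fin n) :
    HasDerivAt (fun x => NormedSpace.exp (c x • B) i j)
      (((c' • B) * NormedSpace.exp (c x • B)) i j) x := by
  obtain ⟨V, d, hV, rfl⟩ := h
  have hVV : V⁻¹ * V = 1 := Matrix.nonsing_inv_mul _ ((Matrix.isUnit_iff_isUnit_det _).1 hV)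
  have h1 : (c' • (V * Matrix.diagonal d * V⁻¹)) *
      (V * Matrix.diagonal (fun i => Complex.exp (c x * d i)) * V⁻¹) =
      V * Matrix.diagonal (fun i => Complex.exp (c x * d i) * (c' * d i)) * V⁻¹ := by
    calc _ = c' • (V * (Matrix.diagonal d * (V⁻¹ * V) *
          Matrix.diagonal (fun i => Complex.exp (c x * d i))) * V⁻¹) := by
          simp only [Matrix.smul_mul, Matrix.mul_assoc]
      _ = _ := by
          rw [hVV, Matrix.mul_one, Matrix.diagonal_mul_diagonal, ← Matrix.smul_mul,
            ← Matrix.mul_smul, ← Matrix.diagonal_smul]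
          congr 3
          ext k
          simp; ring
  simp only [exp_smul_conj_diagonal hV, h1, conj_diagonal_apply]
  refine HasDerivAt.fun_sum fun k _ => ?_
  exact (((hc.mul_const (d k)).cexp).const_mul (V i k)).mul_const (V⁻¹ k j)

lemma IsDiagonalisable.continuous_exp {B : Matrix (Fin n) (Fin n) ℂ} (h : IsDiagonalisable B)
    {c : ℝ → ℂ} (hc : Continuous c) : Continuous fun x => NormedSpace.exp (c x • B) := by
  obtain ⟨V, d, hV, rfl⟩ := h
  refine continuous_matrix fun i j => ?_
  simp only [exp_smul_conj_diagonal hV, conj_diagonal_apply]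
  fun_prop

/-- The part of the interval `[a, b]` that lies to the left of `x`. -/
def clampLength (a b x : ℝ) : ℝ := max a (min x b) - a

lemma clampLength_of_le {a b x : ℝ} (h : x ≤ a) : clampLength a b x = 0 := by
  rw [clampLength, max_eq_left ((min_le_left _ _).trans h), sub_self]

lemma clampLength_of_ge {a b x : ℝ} (hab : a ≤ b) (h : b ≤ x) : clampLength a b x = b - a := by
  rw [clampLength, min_eq_right h, max_eq_right hab]

lemma clampLength_of_mem {a b x : ℝ} (h : x ∈ Set.Icc a b) : clampLength a b x = x - a := by
  rw [clampLength, min_eq_left h.2, max_eq_right h.1]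

lemma continuous_clampLength (a b : ℝ) : Continuous (clampLength a b) := by
  unfold clampLength; fun_prop

/-- The transfer matrix from the left end point to `x`, for the nodes `t` and coefficients `B`. -/
noncomputable def propagator (z : ℂ) (t : Fin (m + 1) → ℝ) (B : Fin m → Matrix (Fin n) (Fin n) ℂ) (x : ℝ) :
    Matrix (Fin n) (Fin n) ℂ :=
  (List.ofFn fun s : Fin m =>
    NormedSpace.exp ((z * (clampLength (t s.castSucc) (t s.succ) x : ℂ)) • B s)).reverse.prod

/-- The piecewise constant matrix function with value `B s` on the `s`-th interval. -/
noncomputable def piecewiseCoeff (t : Fin (m + 1) → ℝ) (B : Fin m → Matrix (Fin n) (Fin n) ℂ) (x : ℝ) :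
    Matrix (Fin n) (Fin n) ℂ :=
  ∑ s : Fin m, (Set.Ioc (t s.castSucc) (t s.succ)).indicator (fun _ => B s) x

lemma propagator_succ (z : ℂ) (t : Fin (m + 2) → ℝ) (B : Fin (m + 1) → Matrix (Fin n) (Fin n) ℂ)
    (x : ℝ) : propagator z t B x =
      NormedSpace.exp ((z * (clampLength (t (Fin.last m).castSucc) (t (Fin.last (m + 1))) x : ℂ)) •
        B (Fin.last m)) *
      propagator z (fun i => t i.castSucc) (fun s => B s.castSucc) x := by
  rw [propagator, List.ofFn_succ', List.concat_eq_append, List.reverse_append]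
  simp [propagator]

lemma piecewiseCoeff_succ (t : Fin (m + 2) → ℝ) (B : Fin (m + 1) → Matrix (Fin n) (Fin n) ℂ)
    (x : ℝ) : piecewiseCoeff t B x =
      piecewiseCoeff (fun i => t i.castSucc) (fun s => B s.castSucc) x +
      (Set.Ioc (t (Fin.last m).castSucc) (t (Fin.last (m + 1)))).indicator
        (fun _ => B (Fin.last m)) x := by
  rw [piecewiseCoeff, Fin.sum_univ_castSucc]
  simp [piecewiseCoeff]

lemma propagator_of_le (z : ℂ) {t : Fin (m + 1) → ℝ} (ht : StrictMono t)
    (B : Fin m → Matrix (Fin n) (Fin n) ℂ) {x : ℝ} (hx : x ≤ t 0) : propagator z t B x = 1 := by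
  have : ∀ s : Fin m, clampLength (t s.castSucc) (t s.succ) x = 0 := fun s =>
    clampLength_of_le (hx.trans (ht.monotone (Fin.zero_le _)))
  simp [propagator, this, List.ofFn_const]

lemma propagator_of_ge (z : ℂ) {t : Fin (m + 1) → ℝ} (ht : StrictMono t)
    (B : Fin m → Matrix (Fin n) (Fin n) ℂ) {x : ℝ} (hx : t (Fin.last m) ≤ x) :
    propagator z t B x = (List.ofFn fun s : Fin m =>
      NormedSpace.exp ((z * ((t s.succ - t s.castSucc : ℝ) : ℂ)) • B s)).reverse.prod := by
  have : ∀ s : Fin m, clampLength (t s.castSucc) (t s.succ) x = t s.succ - t s.castSucc := fun s =>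
    clampLength_of_ge (ht.monotone (Fin.castSucc_lt_succ).le)
      ((ht.monotone (Fin.le_last _)).trans hx)
  simp only [propagator, this]

lemma continuous_propagator (z : ℂ) (t : Fin (m + 1) → ℝ)
    {B : Fin m → Matrix (Fin n) (Fin n) ℂ} (hB : ∀ s, IsDiagonalisable (B s)) :
    Continuous (propagator z t B) := by
  induction m with
  | zero => exact continuous_const
  | succ m ih =>
    have h : propagator z t B = fun x => _ := funext fun x => propagator_succ z t B x
    rw [h]
    refine Continuous.matrix_mul ((hB _).continuous_exp ?_) (ih _ fun s => hB _)
    have := continuous_clampLength (t (Fin.last m).castSucc) (t (Fin.last (m + 1)))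
    fun_prop

lemma piecewiseCoeff_of_gt {t : Fin (m + 1) → ℝ} (ht : StrictMono t)
    (B : Fin m → Matrix (Fin n) (Fin n) ℂ) {x : ℝ} (hx : t (Fin.last m) < x) :
    piecewiseCoeff t B x = 0 := by
  refine Finset.sum_eq_zero fun s _ => Set.indicator_of_notMem (fun h => ?_) _
  exact absurd (h.2.trans (ht.monotone (Fin.le_last _))) (not_le.2 hx)

lemma piecewiseCoeff_of_mem {t : Fin (m + 1) → ℝ} (ht : StrictMono t)
    (B : Fin m → Matrix (Fin n) (Fin n) ℂ) {x : ℝ} {s : Fin m}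
    (hx : x ∈ Set.Ioc (t s.castSucc) (t s.succ)) : piecewiseCoeff t B x = B s := by
  rw [piecewiseCoeff, Finset.sum_eq_single s, Set.indicator_of_mem hx]
  · intro s' _ hne
    refine Set.indicator_of_notMem (fun h => ?_) _
    rcases lt_or_gt_of_ne hne with hlt | hlt
    · have : t s'.succ ≤ t s.castSucc := ht.monotone (by
        rw [Fin.le_def]; simp only [Fin.val_succ, Fin.val_castSucc]; exact hlt)
      linarith [hx.1, h.2]
    · have : t s.succ ≤ t s'.castSucc := ht.monotone (by
        rw [Fin.le_def]; simp only [Fin.val_succ, Fin.val_castSucc]; exact hlt)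
      linarith [hx.2, h.1]
  · simp

lemma exists_mem_Ioc_of_mem (t : Fin (m + 1) → ℝ) {x : ℝ} (hx : x ∈ Set.Ioc (t 0) (t (Fin.last m))) :
    ∃ s : Fin m, x ∈ Set.Ioc (t s.castSucc) (t s.succ) := by
  induction m with
  | zero => exact absurd (hx.1.trans_le hx.2) (lt_irrefl _)
  | succ m ih =>
    by_cases h : x ≤ t (Fin.last m).castSucc
    · obtain ⟨s, hs⟩ := ih (fun i => t i.castSucc) ⟨hx.1, h⟩
      exact ⟨s.castSucc, hs⟩
    · exact ⟨Fin.last m, not_le.1 h, hx.2⟩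

lemma hasDerivAt_clampLength {a b x : ℝ} (hab : a < b) (ha : x ≠ a) (hb : x ≠ b) :
    HasDerivAt (clampLength a b) ((Set.Ioc a b).indicator (fun _ => 1) x) x := by
  rcases lt_or_gt_of_ne ha with h | h
  · rw [Set.indicator_of_notMem fun hx => absurd hx.1 (not_lt.2 h.le)]
    refine (hasDerivAt_const x (0 : ℝ)).congr_of_eventuallyEq ?_
    filter_upwards [Iio_mem_nhds h] with y hy using clampLength_of_le (le_of_lt hy)
  rcases lt_or_gt_of_ne hb with h' | h'
  · rw [Set.indicator_of_mem (show x ∈ Set.Ioc a b from ⟨h, h'.le⟩)]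
    refine ((hasDerivAt_id x).sub_const a).congr_of_eventuallyEq ?_
    filter_upwards [Ioo_mem_nhds h h'] with y hy using clampLength_of_mem ⟨hy.1.le, hy.2.le⟩
  · rw [Set.indicator_of_notMem fun hx => absurd hx.2 (not_le.2 h')]
    refine (hasDerivAt_const x (b - a)).congr_of_eventuallyEq ?_
    filter_upwards [Ioi_mem_nhds h'] with y hy using clampLength_of_ge hab.le (le_of_lt hy)

/-- The propagator solves the differential equation away from the nodes. -/
lemma hasDerivAt_propagator (z : ℂ) {t : Fin (m + 1) → ℝ} (ht : StrictMono t)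
    {B : Fin m → Matrix (Fin n) (Fin n) ℂ} (hB : ∀ s, IsDiagonalisable (B s)) {x : ℝ}
    (hx : x ∉ Set.range t) (i j : Fin n) :
    HasDerivAt (fun x => propagator z t B x i j)
      ((z • piecewiseCoeff t B x * propagator z t B x) i j) x := by
  induction m generalizing i j with
  | zero => simpa [propagator, piecewiseCoeff] using hasDerivAt_const x _
  | succ m ih =>
    have ht' : StrictMono fun i : Fin (m + 1) => t i.castSucc :=
      ht.comp (Fin.strictMono_castSucc)
    have hlt : t (Fin.last m).castSucc < t (Fin.last (m + 1)) :=
      ht (Fin.castSucc_lt_last _)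
    have hP := fun i j => ih ht' (fun s => hB s.castSucc)
      (fun ⟨k, hk⟩ => hx ⟨k.castSucc, hk⟩) i j
    set P := propagator z (fun i => t i.castSucc) (fun s => B s.castSucc) with hPdef
    set N := piecewiseCoeff (fun i => t i.castSucc) (fun s => B s.castSucc) x with hN
    set a := t (Fin.last m).castSucc with ha
    set b := t (Fin.last (m + 1)) with hb
    set X : ℝ → Matrix (Fin n) (Fin n) ℂ := fun y =>
      NormedSpace.exp ((z * (clampLength a b y : ℂ)) • B (Fin.last m)) with hXdef
    have hxa : x ≠ a := fun h => hx ⟨_, h.symm⟩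
    have hxb : x ≠ b := fun h => hx ⟨_, h.symm⟩
    set I : Matrix (Fin n) (Fin n) ℂ :=
      (Set.Ioc a b).indicator (fun _ => B (Fin.last m)) x with hI
    have hX : ∀ i j, HasDerivAt (fun y => X y i j) ((z • I * X x) i j) x := by
      intro i j
      have hc := ((hasDerivAt_clampLength hlt hxa hxb).ofReal_comp).const_mul z
      refine ((hB (Fin.last m)).hasDerivAt_exp hc i j).congr_deriv ?_
      by_cases hmem : x ∈ Set.Ioc a b <;> simp [hI, hmem, hXdef]
    -- No commutation of the coefficient matrices is needed: left of the last interval its factor is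
    -- still 1, and to the right the earlier coefficient is 0.
    have hcomm : X x * (z • N) = z • N * X x := by
      rcases lt_or_gt_of_ne hxa with h | h
      · have : X x = 1 := by simp [hXdef, clampLength_of_le h.le]
        rw [this, Matrix.one_mul, Matrix.mul_one]
      · have : N = 0 := piecewiseCoeff_of_gt ht' _ h
        rw [this, smul_zero, Matrix.mul_zero, Matrix.zero_mul]
    have hderiv : HasDerivAt (fun y => (X y * P y) i j)
        ((z • I * X x * P x + X x * (z • N * P x)) i j) x := by
      simp only [Matrix.mul_apply (M := X _)]
      refine (HasDerivAt.fun_sum fun k _ => (hX i k).mul (hP k j)).congr_deriv ?_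
      rw [Finset.sum_add_distrib, Matrix.add_apply, Matrix.mul_apply, Matrix.mul_apply]
    simp only [propagator_succ, piecewiseCoeff_succ]
    refine hderiv.congr_deriv ?_
    rw [← Matrix.mul_assoc (X x), hcomm, smul_add, Matrix.add_mul, Matrix.mul_assoc,
      Matrix.mul_assoc, add_comm]

end Propagator

/-! ### Uniqueness and the integral form of the equation. -/

section Volterra

/-- A continuous solution of a homogeneous Volterra inequality vanishes. -/
lemma eq_zero_of_norm_le_integral {E : Type*} [NormedAddCommGroup E] {d : ℝ → E} {a b K : ℝ}
    (hab : a ≤ b) (hd : ContinuousOn d (Set.Icc a b))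
    (h : ∀ x ∈ Set.Icc a b, ‖d x‖ ≤ K * ∫ y in a..x, ‖d y‖) : ∀ x ∈ Set.Icc a b, d x = 0 := by
  -- Extending `d` by constants outside the interval makes the integrand continuous on ℝ, so `D` is
  -- differentiable everywhere and Gronwall's inequality with zero initial value applies.
  set D : ℝ → ℝ := fun x => ∫ y in a..x, ‖Set.IccExtend hab (Set.domRestrict _ d) y‖ with hD
  have hcont : Continuous fun y => ‖Set.IccExtend hab (Set.domRestrict _ d) y‖ :=
    (hd.domRestrict.Icc_extend').norm
  have heq : ∀ x ∈ Set.Icc a b, D x = ∫ y in a..x, ‖d y‖ := by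
    intro x hx
    refine intervalIntegral.integral_congr fun y hy => ?_
    rw [Set.uIcc_of_le hx.1] at hy
    rw [Set.IccExtend_of_mem _ _ ⟨hy.1, hy.2.trans hx.2⟩, Set.domRestrict_apply]
  have hderiv : ∀ x, HasDerivAt D ‖Set.IccExtend hab (Set.domRestrict _ d) x‖ x := fun x =>
    (hcont.integral_hasStrictDerivAt a x).hasDerivAt
  have hzero : ∀ x ∈ Set.Icc a b, ‖D x‖ ≤ gronwallBound 0 K 0 (x - a) := by
    refine norm_le_gronwallBound_of_norm_deriv_right_le
      (fun x _ => (hderiv x).continuousAt.continuousWithinAt)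
      (fun x _ => (hderiv x).hasDerivWithinAt) (by simp [hD]) fun x hx => ?_
    have hx' : x ∈ Set.Icc a b := ⟨hx.1, hx.2.le⟩
    have hnn : 0 ≤ D x := intervalIntegral.integral_nonneg hx.1 fun y _ => norm_nonneg _
    rw [norm_norm, Set.IccExtend_of_mem _ _ hx', Set.domRestrict_apply, Real.norm_of_nonneg hnn,
      heq x hx', add_zero]
    exact h x hx'
  intro x hx
  have h0 : D x = 0 := by
    have := hzero x hx
    rw [gronwallBound_ε0_δ0] at this
    exact norm_le_zero_iff.1 this
  have := h x hx
  rw [← heq x hx, h0, mul_zero] at this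
  exact norm_le_zero_iff.1 this

variable {n m : ℕ}

lemma norm_mulVec_le (A : Matrix (Fin n) (Fin n) ℂ) (v : Fin n → ℂ) :
    ‖A.mulVec v‖ ≤ (∑ i, ∑ j, ‖A i j‖) * ‖v‖ := by
  refine (pi_norm_le_iff_of_nonneg (by positivity)).2 fun i => ?_
  calc ‖A.mulVec v i‖ ≤ ∑ j, ‖A i j * v j‖ :=
        norm_sum_le Finset.univ fun j => A i j * v j
    _ ≤ ∑ j, ‖A i j‖ * ‖v‖ := by
        refine Finset.sum_le_sum fun j _ => ?_
        rw [norm_mul]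
        gcongr
        exact norm_le_pi_norm v j
    _ = (∑ j, ‖A i j‖) * ‖v‖ := by rw [Finset.sum_mul]
    _ ≤ (∑ i, ∑ j, ‖A i j‖) * ‖v‖ := by
        refine mul_le_mul_of_nonneg_right ?_ (norm_nonneg v)
        exact Finset.single_le_sum (f := fun i => ∑ j, ‖A i j‖)
          (fun i _ => Finset.sum_nonneg fun j _ => norm_nonneg _) (Finset.mem_univ i)

lemma piecewiseCoeff_mulVec (t : Fin (m + 1) → ℝ) (B : Fin m → Matrix (Fin n) (Fin n) ℂ) (x : ℝ)
    (v : Fin n → ℂ) : (piecewiseCoeff t B x).mulVec v =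
      ∑ s : Fin m, (Set.Ioc (t s.castSucc) (t s.succ)).indicator (fun _ => (B s).mulVec v) x := by
  rw [piecewiseCoeff, Matrix.sum_mulVec]
  refine Finset.sum_congr rfl fun s _ => ?_
  by_cases h : x ∈ Set.Ioc (t s.castSucc) (t s.succ) <;> simp [h]

lemma exists_norm_piecewiseCoeff_mulVec_le (t : Fin (m + 1) → ℝ)
    (B : Fin m → Matrix (Fin n) (Fin n) ℂ) : ∃ K : ℝ, 0 ≤ K ∧ ∀ x v,
      ‖(piecewiseCoeff t B x).mulVec v‖ ≤ K * ‖v‖ := by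
  refine ⟨∑ s, ∑ i, ∑ j, ‖B s i j‖, by positivity, fun x v => ?_⟩
  rw [piecewiseCoeff_mulVec, Finset.sum_mul]
  refine (norm_sum_le _ _).trans (Finset.sum_le_sum fun s _ => ?_)
  exact (norm_indicator_le_norm_self _ _).trans (norm_mulVec_le _ _)

lemma memLp_piecewiseCoeff_mulVec (t : Fin (m + 1) → ℝ) (B : Fin m → Matrix (Fin n) (Fin n) ℂ)
    {f : ℝ → Fin n → ℂ} {a b : ℝ} (hf : ContinuousOn f (Set.Icc a b)) :
    MemLp (fun x => (piecewiseCoeff t B x).mulVec (f x)) 2 (volume.restrict (Set.Icc a b)) := by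
  have h1 : (fun x => (piecewiseCoeff t B x).mulVec (f x)) = fun x => ∑ s : Fin m,
      (Set.Ioc (t s.castSucc) (t s.succ)).indicator (fun x => (B s).mulVec (f x)) x := by
    ext1 x
    rw [piecewiseCoeff_mulVec]
    refine Finset.sum_congr rfl fun s _ => ?_
    by_cases h : x ∈ Set.Ioc (t s.castSucc) (t s.succ) <;> simp [h]
  rw [h1]
  refine memLp_finsetSum _ fun s _ => MemLp.indicator measurableSet_Ioc ?_
  have hc : ContinuousOn (fun x => (B s).mulVec (f x)) (Set.Icc a b) := by
    have : Continuous fun v : Fin n → ℂ => (B s).mulVec v := by fun_prop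
    exact this.comp_continuousOn hf
  obtain ⟨C, hC⟩ := isCompact_Icc.exists_bound_of_continuousOn hc
  exact MemLp.of_bound (hc.aestronglyMeasurable measurableSet_Icc) C
    ((ae_restrict_iff' measurableSet_Icc).2 (ae_of_all _ hC))

lemma MemLp.intervalIntegrable_of_mem {g : ℝ → Fin n → ℂ} {a b x : ℝ}
    (hg : MemLp g 2 (volume.restrict (Set.Icc a b))) (hx : x ∈ Set.Icc a b) :
    IntervalIntegrable g volume a x := by
  have h1 : IntegrableOn g (Set.Icc a b) := hg.integrable one_le_two
  rw [intervalIntegrable_iff_integrableOn_Icc_of_le hx.1]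
  exact h1.mono_set (Set.Icc_subset_Icc_right hx.2)

/-- The integral equation satisfied by the propagator. -/
lemma propagator_mulVec_eq_integral (z : ℂ) {t : Fin (m + 1) → ℝ} (ht : StrictMono t)
    {B : Fin m → Matrix (Fin n) (Fin n) ℂ} (hB : ∀ s, IsDiagonalisable (B s)) (v : Fin n → ℂ)
    {x : ℝ} (hx : x ∈ Set.Icc (t 0) (t (Fin.last m))) :
    (propagator z t B x).mulVec v = v + ∫ y in (t 0)..x,
      (piecewiseCoeff t B y).mulVec (z • (propagator z t B y).mulVec v) := by
  have hcont : Continuous fun y => (propagator z t B y).mulVec v :=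
    (continuous_propagator z t hB).matrix_mulVec continuous_const
  have hint : IntervalIntegrable (fun y => (piecewiseCoeff t B y).mulVec
      (z • (propagator z t B y).mulVec v)) volume (t 0) x :=
    MemLp.intervalIntegrable_of_mem (memLp_piecewiseCoeff_mulVec t B
      (hcont.const_smul z).continuousOn) hx
  have h := integral_eq_of_hasDerivAt_off_countable (fun y => (propagator z t B y).mulVec v) _
    (Set.finite_range t).countable hcont.continuousOn (fun y hy => ?_) hint
  · rw [h, propagator_of_le z ht B le_rfl, Matrix.one_mulVec]
    abel
  · refine hasDerivAt_pi.2 fun i => ?_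
    have h1 : HasDerivAt (fun y => ∑ j, propagator z t B y i j * v j)
        (∑ j, (z • piecewiseCoeff t B y * propagator z t B y) i j * v j) y :=
      HasDerivAt.fun_sum fun j _ => (hasDerivAt_propagator z ht hB hy.2 i j).mul_const (v j)
    refine h1.congr_deriv ?_
    change ((z • piecewiseCoeff t B y * propagator z t B y).mulVec v) i = _
    rw [← Matrix.mulVec_mulVec, Matrix.smul_mulVec, Matrix.mulVec_smul]

end Volterra

/-! ### Eigenvalues as zeros of the characteristic determinant. -/

namespace PiecewiseSystem

variable {n m : ℕ} (L : PiecewiseSystem n m)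

lemma isDiagonalisable_inv (s : Fin m) : IsDiagonalisable (L.A s)⁻¹ :=
  IsDiagonalisable.inv (L.diagonalizable_A s)

lemma coeff_eq : L.coeff = piecewiseCoeff L.t L.A := rfl

lemma transfer_eq (z : ℂ) : L.transfer z = propagator z L.t (fun s => (L.A s)⁻¹) L.β := by
  rw [propagator_of_ge z L.strictMono_t _ (le_refl L.β)]
  rfl

lemma α_le_β : L.α ≤ L.β := L.strictMono_t.monotone (Fin.zero_le _)

/-- The pieces are open on the left, so `coeff` is 0 at the left end point itself, which has to be
left out; it is a null set. -/
lemma coeff_mul_inv {x : ℝ} (hx : x ∈ Set.Ioc L.α L.β) :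
    L.coeff x * piecewiseCoeff L.t (fun s => (L.A s)⁻¹) x = 1 ∧
      piecewiseCoeff L.t (fun s => (L.A s)⁻¹) x * L.coeff x = 1 := by
  obtain ⟨s, hs⟩ := exists_mem_Ioc_of_mem L.t hx
  rw [coeff_eq, piecewiseCoeff_of_mem L.strictMono_t _ hs, piecewiseCoeff_of_mem L.strictMono_t _ hs]
  have := (Matrix.isUnit_iff_isUnit_det _).1 (L.isUnit_A s)
  exact ⟨Matrix.mul_nonsing_inv _ this, Matrix.nonsing_inv_mul _ this⟩

lemma ae_mem_Ioc : ∀ᵐ x ∂(volume.restrict (Set.Icc L.α L.β)), x ∈ Set.Ioc L.α L.β := by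
  rw [← restrict_Ioc_eq_restrict_Icc]
  exact ae_restrict_mem measurableSet_Ioc

/-- Solutions of the differential equation are propagated from the left end point. -/
lemma eq_propagator_mulVec {z : ℂ} {f g : ℝ → Fin n → ℂ} (hfg : IsW12 L.α L.β f g)
    (hode : ∀ᵐ x ∂(volume.restrict (Set.Icc L.α L.β)), Matrix.mulVec (L.coeff x) (g x) = z • f x) :
    ∀ x ∈ Set.Icc L.α L.β,
      f x = (propagator z L.t (fun s => (L.A s)⁻¹) x).mulVec (f L.α) := by
  obtain ⟨hg, hf⟩ := hfg
  set B : Fin m → Matrix (Fin n) (Fin n) ℂ := fun s => (L.A s)⁻¹ with hB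
  have hdiag : ∀ s, IsDiagonalisable (B s) := L.isDiagonalisable_inv
  set h : ℝ → Fin n → ℂ := fun x => (propagator z L.t B x).mulVec (f L.α) with hh
  have hgeq : ∀ᵐ x ∂(volume.restrict (Set.Icc L.α L.β)),
      g x = (piecewiseCoeff L.t B x).mulVec (z • f x) := by
    filter_upwards [hode, L.ae_mem_Ioc] with x hx hmem
    rw [← hx, Matrix.mulVec_mulVec, (L.coeff_mul_inv hmem).2, Matrix.one_mulVec]
  have hfc : ContinuousOn f (Set.Icc L.α L.β) := by
    have h1 : ContinuousOn (fun x => f L.α + ∫ y in L.α..x, g y) (Set.Icc L.α L.β) := by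
      have := intervalIntegral.continuousOn_primitive_interval (f := g) (μ := volume)
        (a := L.α) (b := L.β) (by rw [Set.uIcc_of_le L.α_le_β]; exact hg.integrable one_le_two)
      rw [Set.uIcc_of_le L.α_le_β] at this
      exact continuousOn_const.add this
    exact h1.congr hf
  have hhc : Continuous h := (continuous_propagator z L.t hdiag).matrix_mulVec continuous_const
  obtain ⟨K, hK0, hK⟩ := exists_norm_piecewiseCoeff_mulVec_le L.t B
  -- Both functions satisfy the same integral equation with the same initial value, so their
  -- difference satisfies the homogeneous one.
  have hd : ∀ x ∈ Set.Icc L.α L.β, f x - h x =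
      ∫ y in L.α..x, (piecewiseCoeff L.t B y).mulVec (z • (f y - h y)) := by
    intro x hx
    have hfint : f x = f L.α + ∫ y in L.α..x, (piecewiseCoeff L.t B y).mulVec (z • f y) := by
      rw [hf x hx]
      congr 1
      refine intervalIntegral.integral_congr_ae_restrict ?_
      rw [Set.uIoc_of_le hx.1]
      exact ae_restrict_of_ae_restrict_of_subset
        (Set.Ioc_subset_Icc_self.trans (Set.Icc_subset_Icc_right hx.2)) hgeq
    have hhint : h x = f L.α + ∫ y in L.α..x, (piecewiseCoeff L.t B y).mulVec (z • h y) :=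
      propagator_mulVec_eq_integral z L.strictMono_t hdiag (f L.α) hx
    rw [hfint, hhint, add_sub_add_left_eq_sub, ← intervalIntegral.integral_sub]
    · simp only [smul_sub, Matrix.mulVec_sub]
    · exact MemLp.intervalIntegrable_of_mem
        (memLp_piecewiseCoeff_mulVec L.t B (hfc.const_smul z)) hx
    · exact MemLp.intervalIntegrable_of_mem
        (memLp_piecewiseCoeff_mulVec L.t B (hhc.const_smul z).continuousOn) hx
  have hcd : ContinuousOn (fun x => f x - h x) (Set.Icc L.α L.β) := hfc.sub hhc.continuousOn
  have hzero := eq_zero_of_norm_le_integral (d := fun x => f x - h x) (K := K * ‖z‖) L.α_le_β hcd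
    fun x hx => by
      rw [hd x hx, ← intervalIntegral.integral_const_mul]
      refine intervalIntegral.norm_integral_le_of_norm_le hx.1 (ae_of_all _ fun y _ => ?_) ?_
      · refine (hK _ _).trans ?_
        rw [norm_smul, mul_assoc]
      · refine (ContinuousOn.intervalIntegrable ?_).const_mul _
        rw [Set.uIcc_of_le hx.1]
        exact (hcd.mono (Set.Icc_subset_Icc_right hx.2)).norm
  exact fun x hx => sub_eq_zero.1 (hzero x hx)

/-- The eigenvalues are the zeros of the characteristic function. -/
theorem isEigenvalue_iff (z : ℂ) : L.IsEigenvalue z ↔ L.charDet z = 0 := by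
  rw [charDet, ← Matrix.exists_mulVec_eq_zero_iff, transfer_eq]
  have hα : L.α ∈ Set.Icc L.α L.β := ⟨le_rfl, L.α_le_β⟩
  have hβ : L.β ∈ Set.Icc L.α L.β := ⟨L.α_le_β, le_rfl⟩
  constructor
  · rintro ⟨f, g, hfg, hbc, hode, x, hx, hfx⟩
    have hf := L.eq_propagator_mulVec hfg hode
    -- A zero initial value would be propagated to the zero function.
    refine ⟨f L.α, fun h0 => hfx ?_, ?_⟩
    · rw [hf x hx, h0, Matrix.mulVec_zero]
    · rw [Matrix.add_mulVec, ← Matrix.mulVec_mulVec, ← hf L.β hβ]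
      exact hbc
  · rintro ⟨v, hv, hv0⟩
    set B : Fin m → Matrix (Fin n) (Fin n) ℂ := fun s => (L.A s)⁻¹ with hB
    have hdiag : ∀ s, IsDiagonalisable (B s) := L.isDiagonalisable_inv
    set h : ℝ → Fin n → ℂ := fun x => (propagator z L.t B x).mulVec v with hh
    have hhc : Continuous h := (continuous_propagator z L.t hdiag).matrix_mulVec continuous_const
    have hhα : h L.α = v := by
      rw [hh]
      simp only
      rw [propagator_of_le z L.strictMono_t B (le_refl L.α), Matrix.one_mulVec]
    refine ⟨h, fun x => (piecewiseCoeff L.t B x).mulVec (z • h x),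
      ⟨memLp_piecewiseCoeff_mulVec L.t B (hhc.const_smul z).continuousOn, fun x hx => ?_⟩, ?_, ?_,
      L.α, hα, by rwa [hhα]⟩
    · rw [hhα]
      exact propagator_mulVec_eq_integral z L.strictMono_t hdiag v hx
    · rw [hhα, ← hv0, Matrix.add_mulVec, ← Matrix.mulVec_mulVec]
    · filter_upwards [L.ae_mem_Ioc] with x hx
      rw [Matrix.mulVec_mulVec, (L.coeff_mul_inv hx).1, Matrix.one_mulVec]

end PiecewiseSystem

/-! ### The characteristic determinant is an exponential sum. -/

section ExponentialSums

/-- The exponential functions, as a character with values in the algebra of functions. -/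
noncomputable def expCharacter : Multiplicative ℂ →* (ℂ → ℂ) where
  toFun c z := Complex.exp (z * (starRingEnd ℂ) c.toAdd)
  map_one' := by ext z; simp
  map_mul' c d := by ext z; simp [mul_add, Complex.exp_add]

/-- The algebra of exponential sums. -/
noncomputable def expAlgebra : Subalgebra ℂ (ℂ → ℂ) :=
  (AddMonoidAlgebra.lift ℂ (ℂ → ℂ) ℂ expCharacter).range

lemma exp_mul_mem_expAlgebra (c : ℂ) : (fun z => Complex.exp (z * c)) ∈ expAlgebra := by
  refine ⟨AddMonoidAlgebra.single ((starRingEnd ℂ) c) 1, ?_⟩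
  ext z
  simp [AddMonoidAlgebra.lift_single, expCharacter]

lemma const_mem_expAlgebra (a : ℂ) : (fun _ => a) ∈ expAlgebra := expAlgebra.algebraMap_mem a

/-- Every exponential sum has a reduced form. -/
lemma exists_expSum_of_mem_expAlgebra {F : ℂ → ℂ} (hF : F ∈ expAlgebra) :
    ∃ (R : ℕ) (δ γ : Fin R → ℂ), Function.Injective γ ∧ (∀ r, δ r ≠ 0) ∧
      ∀ z : ℂ, F z = expSum δ γ z := by
  obtain ⟨f, rfl⟩ := hF
  have key : ∀ g : ℂ →₀ ℂ, ∃ (R : ℕ) (δ γ : Fin R → ℂ), Function.Injective γ ∧ (∀ r, δ r ≠ 0) ∧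
      ∀ z : ℂ, g.sum (fun c a => a * Complex.exp (z * (starRingEnd ℂ) c)) = expSum δ γ z := by
    intro g
    -- Enumerating the support makes the exponents distinct and the coefficients nonzero; an empty
    -- support gives the empty sum.
    refine ⟨g.support.card, fun r => g (g.support.equivFin.symm r),
      fun r => g.support.equivFin.symm r, ?_, fun r => ?_, fun z => ?_⟩
    · exact Subtype.val_injective.comp g.support.equivFin.symm.injective
    · exact Finsupp.mem_support_iff.1 (g.support.equivFin.symm r).2
    · rw [Finsupp.sum, expSum, ← Finset.sum_coe_sort,
        ← Equiv.sum_comp g.support.equivFin.symm]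
  obtain ⟨R, δ, γ, h1, h2, h3⟩ := key f.coeff
  refine ⟨R, δ, γ, h1, h2, fun z => ?_⟩
  rw [← h3]
  simp [AddMonoidAlgebra.lift_apply, Finsupp.sum, expCharacter]

variable {n m : ℕ}

/-- Matrix functions whose entries are exponential sums. -/
def IsExpMatrix (M : ℂ → Matrix (Fin n) (Fin n) ℂ) : Prop :=
  ∀ i j, (fun z => M z i j) ∈ expAlgebra

lemma isExpMatrix_const (A : Matrix (Fin n) (Fin n) ℂ) : IsExpMatrix fun _ => A :=
  fun _ _ => const_mem_expAlgebra _

lemma IsExpMatrix.add {M N : ℂ → Matrix (Fin n) (Fin n) ℂ} (hM : IsExpMatrix M)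
    (hN : IsExpMatrix N) : IsExpMatrix fun z => M z + N z :=
  fun i j => expAlgebra.add_mem (hM i j) (hN i j)

lemma IsExpMatrix.mul {M N : ℂ → Matrix (Fin n) (Fin n) ℂ} (hM : IsExpMatrix M)
    (hN : IsExpMatrix N) : IsExpMatrix fun z => M z * N z := by
  intro i j
  have : (fun z => (M z * N z) i j) = ∑ k, (fun z => M z i k) * (fun z => N z k j) := by
    ext z; simp [Matrix.mul_apply]
  rw [this]
  exact expAlgebra.sum_mem fun k _ => expAlgebra.mul_mem (hM i k) (hN k j)

lemma IsExpMatrix.det_mem {M : ℂ → Matrix (Fin n) (Fin n) ℂ} (hM : IsExpMatrix M) :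
    (fun z => (M z).det) ∈ expAlgebra := by
  have : (fun z => (M z).det) = ∑ σ : Equiv.Perm (Fin n),
      (fun _ => ((Equiv.Perm.sign σ : ℤ) : ℂ)) * ∏ i, (fun z => M z (σ i) i) := by
    ext z; simp [Matrix.det_apply']
  rw [this]
  exact expAlgebra.sum_mem fun σ _ => expAlgebra.mul_mem (const_mem_expAlgebra _)
    (expAlgebra.prod_mem fun i _ => hM _ _)

lemma isExpMatrix_list_prod {X : Fin m → ℂ → Matrix (Fin n) (Fin n) ℂ}
    (hX : ∀ s, IsExpMatrix (X s)) :
    IsExpMatrix fun z => (List.ofFn fun s => X s z).reverse.prod := by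
  induction m with
  | zero => simpa using isExpMatrix_const 1
  | succ m ih =>
    simp only [List.ofFn_succ', List.concat_eq_append, List.reverse_append,
      List.reverse_singleton, List.singleton_append, List.prod_cons]
    exact (hX _).mul (ih fun s => hX _)

/-- Diagonalisability keeps the coefficients constant: a Jordan block would bring in powers of z. -/
lemma IsDiagonalisable.isExpMatrix_exp {B : Matrix (Fin n) (Fin n) ℂ} (h : IsDiagonalisable B)
    (l : ℂ) : IsExpMatrix fun z => NormedSpace.exp ((z * l) • B) := by
  obtain ⟨V, d, hV, rfl⟩ := h
  simp only [exp_smul_conj_diagonal hV]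
  refine ((isExpMatrix_const V).mul fun i j => ?_).mul (isExpMatrix_const V⁻¹)
  by_cases hij : i = j
  · subst hij
    simpa [mul_assoc] using exp_mul_mem_expAlgebra (l * d i)
  · simpa [Matrix.diagonal_apply_ne _ hij] using const_mem_expAlgebra 0

lemma PiecewiseSystem.charDet_mem_expAlgebra (L : PiecewiseSystem n m) :
    L.charDet ∈ expAlgebra :=
  ((isExpMatrix_const L.S).add ((isExpMatrix_const L.T).mul (isExpMatrix_list_prod fun s =>
    (L.isDiagonalisable_inv s).isExpMatrix_exp _))).det_mem

lemma PiecewiseSystem.eigenvaluesIn_eq (L : PiecewiseSystem n m) {R : ℕ} {δ γ : Fin R → ℂ}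
    (h : ∀ z : ℂ, L.charDet z = expSum δ γ z) (E : ℝ) :
    L.eigenvaluesIn E = zerosIn (expSum δ γ) E := by
  ext z
  simp [eigenvaluesIn, zerosIn, L.isEigenvalue_iff, h]

end ExponentialSums

theorem corollary7 :
    (∀ (R : ℕ) (δ γ : Fin R → ℂ), IsGeneric δ γ →
      (∀ E : ℝ, (zerosIn (expSum δ γ) E).Finite) ∧
      (fun E : ℝ => (zeroCount (expSum δ γ) E : ℝ) - perimeter (hull γ) * E / (2 * Real.pi))
        =O[atTop] (fun _ => (1 : ℝ)) ∧
      (fun E : ℝ => (zeroCountMult (expSum δ γ) E : ℝ) - perimeter (hull γ) * E / (2 * Real.pi))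
        =O[atTop] (fun _ => (1 : ℝ))) ∧
    (∀ (n m : ℕ) (L : PiecewiseSystem n m),
      (∀ z : ℂ, L.IsEigenvalue z ↔ L.charDet z = 0) ∧
      (∃ (R : ℕ) (δ γ : Fin R → ℂ), Function.Injective γ ∧ (∀ r, δ r ≠ 0) ∧
        ∀ z : ℂ, L.charDet z = expSum δ γ z) ∧
      (∀ (R : ℕ) (δ γ : Fin R → ℂ), IsGeneric δ γ → (∀ z : ℂ, L.charDet z = expSum δ γ z) →
        (∀ E : ℝ, (L.eigenvaluesIn E).Finite) ∧
        (fun E : ℝ => ((L.eigenvaluesIn E).ncard : ℝ) - perimeter (hull γ) * E / (2 * Real.pi))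
          =O[atTop] (fun _ => (1 : ℝ)))) := by
  refine ⟨fun R δ γ hg => ⟨hg.finite_zerosIn, hg.zeroCount_isBigO, hg.zeroCountMult_isBigO⟩,
    fun n m L => ⟨L.isEigenvalue_iff, exists_expSum_of_mem_expAlgebra L.charDet_mem_expAlgebra,
      fun R δ γ hg h => ?_⟩⟩
  simp only [L.eigenvaluesIn_eq h]
  exact ⟨hg.finite_zerosIn, hg.zeroCount_isBigO⟩
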